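/- Let $(\mathscr{C},\mathbb{E},\mathfrak{s})$ be a Krull–Schmidt extriangulated category (in the sense of Nakaoka–Palu) with enough projectives and enough injectives that satisfies the weak idempotent completeness condition (WIC): if $gf$ is an inflation then so is $f$, and if $gf$ is a deflation then so is $g$. "Subcategory" means full additive subcategory closed under isomorphisms and direct summands. The higher extension groups are $\mathbb{E}^{i+1}(X,Y)=\mathbb{E}(\Omega^iX,Y)$, $i\ge 0$, where $\Omega^i X$ is an $i$-th syzygy of $X$. For a class $\omega$ of objects closed under isomorphisms put $$\omega^{\perp}=\{Y\mid \mathbb{E}^i(X,Y)=0\ \forall i\ge1,\ \forall X\in\omega\},\qquad {}^{\perp}\omega=\{Y\mid \mathbb{E}^i(Y,X)=0\ \forall i\ge1,\ \forall X\in\omega\}.$$ - $\hat\omega$ is the class of all $A$ for which there are $n\ge0$ and an $\mathbb{E}$-triangle sequence $W_n\to\cdots\to W_0\to A$ with all $W_i\in\omega$. It consists of $\mathbb{E}$-triangles $K_{i+1}\to W_i\to K_i\dashrightarrow$ for $0\le i<n$, with $K_0=A$ and $K_n\cong W_n$. Dually, $\check\omega$ is the class of all $A$ with a finite $\mathbb{E}$-triangle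 sequence $A\to W^0\to\cdots\to W^n$, all $W^i\in\omega$. - ${}_{\omega}\mathcal{X}$ is the class of all $A$ for which there are $\mathbb{E}$-triangles $K_{i+1}\to W_i\to K_i\dashrightarrow$ for all $i\ge0$, with $K_0=A$, all $W_i\in\omega$ and all $K_i\in\omega^{\perp}$. - $\omega$ is self-orthogonal if $\omega\subseteq\omega^{\perp}$. A subcategory is finite if it equals $\mathrm{add}(T)$ for some object $T$. - A subcategory $\mathcal{T}$ is $\mathcal{C}$-tilting if $\mathcal{C}$ and $\mathcal{T}$ are self-orthogonal subcategories, $\mathcal{T}\subseteq\hat{\mathcal{C}}$ and $\mathcal{C}\subseteq\check{\mathcal{T}}$. - A relative injective cogenerator of $\mathcal{Y}$ is a subcategory $\mathcal{I}\subseteq\mathcal{Y}\cap\mathcal{Y}^{\perp}$ such that each $Y\in\mathcal{Y}$ has an $\mathbb{E}$-triangle $Y\to I\to Y'\dashrightarrow$ with $I\in\mathcal{I}$ and $Y'\in\mathcal{Y}$. - $\mathcal{Y}$ is finitely filtered if there is a finite set $\mathcal{S}$ of objects of $\mathcal{Y}$ such that each $M\in\mathcal{Y}$ has a chain of $\mathbb{E}$-triangles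 $M_{i-1}\to M_i\to S_i\dashrightarrow$, $1\le i\le n$, with $M_0=0$, $M_n=M$ and all $S_i\in\mathcal{S}$. - A subcategory $\mathcal{D}\subseteq\mathcal{Y}$ is relative coresolving in $\mathcal{Y}$ if it is closed under extensions, direct summands and cones of inflations and contains every injective object of $\mathcal{Y}$. An object $J\in\mathcal{Y}$ is injective in $\mathcal{Y}$ if for every $\mathbb{E}$-triangle $A\to B\to C\dashrightarrow$ with $A,B,C\in\mathcal{Y}$ every morphism $A\to J$ extends to $B$. - $\mathcal{D}$ is strongly covariantly finite in $\mathcal{Y}$ if every $A\in\mathcal{Y}$ has an $\mathbb{E}$-triangle $A\xrightarrow{g}D\to V\dashrightarrow$ with $D\in\mathcal{D}$, $V\in\mathcal{Y}$ and $g$ a left $\mathcal{D}$-approximation. **Theorem (first Auslander–Reiten correspondence).** Let $\mathcal{C}$ be a self-orthogonal subcategory of $\mathscr{C}$ such that ${}_{\mathcal{C}}\mathcal{X}$ has a relative injective cogenerator and $({}_{\mathcal{C}}\mathcal{X})^{\vee}$ (that is, $\check\omega$ for $\omega={}_{\mathcal{C}}\mathcal{X}$) is finitely filtered. Then ${}_{\mathcal{T}}\mathcal{X}=\mathcal{T}^{\perp}\cap{}_{\mathcal{C}}\mathcal{X}$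 for every finite $\mathcal{C}$-tilting subcategory $\mathcal{T}$, and $$\mathcal{T}\longmapsto {}_{\mathcal{T}}\mathcal{X}=\mathcal{T}^{\perp}\cap{}_{\mathcal{C}}\mathcal{X}$$ is a bijection from the finite $\mathcal{C}$-tilting subcategories onto the subcategories $\mathcal{D}$ that are relative coresolving and strongly covariantly finite in ${}_{\mathcal{C}}\mathcal{X}$ and satisfy $\check{\mathcal{D}}=({}_{\mathcal{C}}\mathcal{X})^{\vee}$. Its inverse is $\mathcal{D}\mapsto{}^{\perp}\mathcal{D}\cap\mathcal{D}$. -/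

import Mathlib

open CategoryTheory CategoryTheory.Limits Opposite

universe w v u

/-- An extriangulated category structure (Nakaoka-Palu) on an additive category `𝒞`: a biadditive
functor `E` with values in abelian groups and an additive realization of it, subject to the axioms
(ET3), (ET3)ᵒᵖ, (ET4), (ET4)ᵒᵖ.

The assignment `δ ↦ 𝔰(δ)` of an equivalence class of sequences `A ⟶ B ⟶ C` to every
`δ ∈ E(C, A)` is recorded by the relation `Realizes x y δ`, meaning `𝔰(δ) = [A -x-> B -y-> C]`; the
fields `exists_realizes`, `realizes_unique`, `realizes_of_equiv` say that the sequences realizing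
`δ` form exactly one equivalence class. -/
structure Extriangulated (𝒞 : Type u) [Category.{v} 𝒞] [Preadditive 𝒞] [HasZeroObject 𝒞]
    [HasBinaryBiproducts 𝒞] where
  /-- The bifunctor; `E(C, A)` is `(E.obj (op C)).obj A`. -/
  E : 𝒞ᵒᵖ ⥤ 𝒞 ⥤ AddCommGrpCat.{w}
  additive_left : E.Additive
  additive_right : ∀ C : 𝒞ᵒᵖ, (E.obj C).Additive
  /-- `Realizes x y δ` means that `A -x-> B -y-> C` belongs to the class `𝔰(δ)`. -/
  Realizes : ∀ {A B C : 𝒞}, (A ⟶ B) → (B ⟶ C) → (E.obj (op C)).obj A → Prop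
  exists_realizes : ∀ {A C : 𝒞} (δ : (E.obj (op C)).obj A),
    ∃ (B : 𝒞) (x : A ⟶ B) (y : B ⟶ C), Realizes x y δ
  realizes_unique : ∀ {A B B' C : 𝒞} {δ : (E.obj (op C)).obj A} {x : A ⟶ B} {y : B ⟶ C}
    {x' : A ⟶ B'} {y' : B' ⟶ C}, Realizes x y δ → Realizes x' y' δ →
    ∃ b : B ≅ B', x ≫ b.hom = x' ∧ b.hom ≫ y' = y
  realizes_of_equiv : ∀ {A B B' C : 𝒞} {δ : (E.obj (op C)).obj A} {x : A ⟶ B} {y : B ⟶ C}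
    {x' : A ⟶ B'} {y' : B' ⟶ C} (b : B ≅ B'), Realizes x y δ →
    x ≫ b.hom = x' → b.hom ≫ y' = y → Realizes x' y' δ
  /-- Every morphism `(a, c) : δ ⟶ δ'` of extensions is realized by some triple `(a, b, c)`. -/
  realization : ∀ {A B C A' B' C' : 𝒞} {δ : (E.obj (op C)).obj A} {δ' : (E.obj (op C')).obj A'}
    {x : A ⟶ B} {y : B ⟶ C} {x' : A' ⟶ B'} {y' : B' ⟶ C'},
    Realizes x y δ → Realizes x' y' δ' → ∀ (a : A ⟶ A') (c : C ⟶ C'),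
    (E.obj (op C)).map a δ = (E.map c.op).app A' δ' →
    ∃ b : B ⟶ B', x ≫ b = a ≫ x' ∧ y ≫ c = b ≫ y'
  /-- The split extension is realized by the split sequence. -/
  realizes_zero : ∀ A C : 𝒞,
    Realizes (biprod.inl : A ⟶ A ⊞ C) (biprod.snd : A ⊞ C ⟶ C) 0
  /-- `𝔰(δ ⊕ δ') = 𝔰(δ) ⊕ 𝔰(δ')`, where `δ ⊕ δ' ∈ E(C ⊕ C', A ⊕ A')` corresponds to
  `(δ, 0, 0, δ')`. -/
  realizes_sum : ∀ {A B C A' B' C' : 𝒞} {δ : (E.obj (op C)).obj A} {δ' : (E.obj (op C')).obj A'}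
    {x : A ⟶ B} {y : B ⟶ C} {x' : A' ⟶ B'} {y' : B' ⟶ C'},
    Realizes x y δ → Realizes x' y' δ' →
    Realizes (biprod.map x x') (biprod.map y y')
      ((E.obj (op (C ⊞ C'))).map (biprod.inl : A ⟶ A ⊞ A')
          ((E.map (biprod.fst : C ⊞ C' ⟶ C).op).app A δ) +
        (E.obj (op (C ⊞ C'))).map (biprod.inr : A' ⟶ A ⊞ A')
          ((E.map (biprod.snd : C ⊞ C' ⟶ C').op).app A' δ'))
  /-- (ET3) -/
  et3 : ∀ {A B C A' B' C' : 𝒞} {δ : (E.obj (op C)).obj A} {δ' : (E.obj (op C')).obj A'}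
    {x : A ⟶ B} {y : B ⟶ C} {x' : A' ⟶ B'} {y' : B' ⟶ C'},
    Realizes x y δ → Realizes x' y' δ' → ∀ (a : A ⟶ A') (b : B ⟶ B'), x ≫ b = a ≫ x' →
    ∃ c : C ⟶ C', y ≫ c = b ≫ y' ∧ (E.obj (op C)).map a δ = (E.map c.op).app A' δ'
  /-- (ET3)ᵒᵖ -/
  et3_op : ∀ {A B C A' B' C' : 𝒞} {δ : (E.obj (op C)).obj A} {δ' : (E.obj (op C')).obj A'}
    {x : A ⟶ B} {y : B ⟶ C} {x' : A' ⟶ B'} {y' : B' ⟶ C'},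
    Realizes x y δ → Realizes x' y' δ' → ∀ (b : B ⟶ B') (c : C ⟶ C'), y ≫ c = b ≫ y' →
    ∃ a : A ⟶ A', x ≫ b = a ≫ x' ∧ (E.obj (op C)).map a δ = (E.map c.op).app A' δ'
  /-- (ET4) -/
  et4 : ∀ {A B C D F : 𝒞} {δ : (E.obj (op D)).obj A} {δ' : (E.obj (op F)).obj B}
    {f : A ⟶ B} {f' : B ⟶ D} {g : B ⟶ C} {g' : C ⟶ F},
    Realizes f f' δ → Realizes g g' δ' →
    ∃ (X : 𝒞) (d : D ⟶ X) (e : X ⟶ F) (h' : C ⟶ X) (δ'' : (E.obj (op X)).obj A),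
      f' ≫ d = g ≫ h' ∧ h' ≫ e = g' ∧
      Realizes (f ≫ g) h' δ'' ∧
      Realizes d e ((E.obj (op F)).map f' δ') ∧
      (E.map d.op).app A δ'' = δ ∧
      (E.obj (op X)).map f δ'' = (E.map e.op).app B δ'
  /-- (ET4)ᵒᵖ -/
  et4_op : ∀ {A B C D F : 𝒞} {δ : (E.obj (op B)).obj D} {δ' : (E.obj (op C)).obj F}
    {f' : D ⟶ A} {f : A ⟶ B} {g' : F ⟶ B} {g : B ⟶ C},
    Realizes f' f δ → Realizes g' g δ' →
    ∃ (X : 𝒞) (d : D ⟶ X) (e : X ⟶ F) (h' : X ⟶ A) (δ'' : (E.obj (op C)).obj X),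
      d ≫ h' = f' ∧ h' ≫ f = e ≫ g' ∧
      Realizes h' (f ≫ g) δ'' ∧
      Realizes d e ((E.map g'.op).app D δ) ∧
      (E.obj (op C)).map e δ'' = δ' ∧
      (E.obj (op B)).map d δ = (E.map g.op).app X δ''

/-- `𝒞` is Krull-Schmidt: every object is a finite direct sum of objects with local
endomorphism rings. -/
def IsKrullSchmidtCategory (𝒞 : Type u) [Category.{v} 𝒞] [Preadditive 𝒞]
    [HasFiniteBiproducts 𝒞] : Prop :=
  ∀ X : 𝒞, ∃ (n : ℕ) (Y : Fin n → 𝒞), (∀ i, IsLocalRing (End (Y i))) ∧ Nonempty (X ≅ ⨁ Y)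

/-- A subcategory in the sense used throughout: full, additive, closed under isomorphisms and
direct summands. -/
structure IsSubcategory {𝒞 : Type u} [Category.{v} 𝒞] [Preadditive 𝒞] [HasZeroObject 𝒞]
    [HasBinaryBiproducts 𝒞] (P : ObjectProperty 𝒞) : Prop where
  zero : ∀ X : 𝒞, IsZero X → P X
  biprod : ∀ X Y : 𝒞, P X → P Y → P (X ⊞ Y)
  iso : ∀ X Y : 𝒞, (X ≅ Y) → P X → P Y
  summand : ∀ X Y : 𝒞, P (X ⊞ Y) → P X

/-- `add T`: objects isomorphic to direct summands of finite direct sums of copies of `T`. -/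
def addClosure {𝒞 : Type u} [Category.{v} 𝒞] [Preadditive 𝒞] [HasZeroObject 𝒞]
    [HasBinaryBiproducts 𝒞] [HasFiniteBiproducts 𝒞] (T : 𝒞) : ObjectProperty 𝒞 :=
  fun X => ∃ (n : ℕ) (Y : 𝒞), Nonempty (X ⊞ Y ≅ ⨁ (fun _ : Fin n => T))

/-- A subcategory is finite if it is `add T` for some object `T`. -/
def IsFiniteSubcategory {𝒞 : Type u} [Category.{v} 𝒞] [Preadditive 𝒞] [HasZeroObject 𝒞]
    [HasBinaryBiproducts 𝒞] [HasFiniteBiproducts 𝒞] (P : ObjectProperty 𝒞) : Prop :=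
  ∃ T : 𝒞, P = addClosure T

namespace Extriangulated

variable {𝒞 : Type u} [Category.{v} 𝒞] [Preadditive 𝒞] [HasZeroObject 𝒞]
  [HasBinaryBiproducts 𝒞] (S : Extriangulated.{w} 𝒞)

/-- `A -x-> B -y-> C` is a conflation. -/
def IsConflation {A B C : 𝒞} (x : A ⟶ B) (y : B ⟶ C) : Prop :=
  ∃ δ : (S.E.obj (op C)).obj A, S.Realizes x y δ

def IsInflation {A B : 𝒞} (x : A ⟶ B) : Prop :=
  ∃ (C : 𝒞) (y : B ⟶ C), S.IsConflation x y

def IsDeflation {B C : 𝒞} (y : B ⟶ C) : Prop :=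
  ∃ (A : 𝒞) (x : A ⟶ B), S.IsConflation x y

/-- There is an `𝔼`-triangle `A ⟶ B ⟶ C ⇢`. -/
def HasTriangle (A B C : 𝒞) : Prop :=
  ∃ (x : A ⟶ B) (y : B ⟶ C), S.IsConflation x y

/-- The condition (WIC). -/
def WIC : Prop :=
  (∀ {A B C : 𝒞} (f : A ⟶ B) (g : B ⟶ C), S.IsInflation (f ≫ g) → S.IsInflation f) ∧
  (∀ {A B C : 𝒞} (f : A ⟶ B) (g : B ⟶ C), S.IsDeflation (f ≫ g) → S.IsDeflation g)

/-- `P` is a projective object. -/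
def IsProj (P : 𝒞) : Prop :=
  ∀ {A B C : 𝒞} (x : A ⟶ B) (y : B ⟶ C), S.IsConflation x y →
    ∀ c : P ⟶ C, ∃ b : P ⟶ B, b ≫ y = c

/-- `I` is an injective object of the subcategory `Y`: it lies in `Y`, and it has the extension
property for the `𝔼`-triangles whose three terms lie in `Y`. -/
def IsInjIn (Y : ObjectProperty 𝒞) (I : 𝒞) : Prop :=
  Y I ∧ ∀ {A B C : 𝒞} (x : A ⟶ B) (y : B ⟶ C), Y A → Y B → Y C → S.IsConflation x y →
    ∀ a : A ⟶ I, ∃ b : B ⟶ I, x ≫ b = a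

/-- `I` is an injective object. -/
def IsInj (I : 𝒞) : Prop :=
  ∀ {A B C : 𝒞} (x : A ⟶ B) (y : B ⟶ C), S.IsConflation x y →
    ∀ a : A ⟶ I, ∃ b : B ⟶ I, x ≫ b = a

/-- `𝒞` has enough projectives. -/
class HasEnoughProj : Prop where
  exists_triangle : ∀ C : 𝒞, ∃ A P : 𝒞, S.IsProj P ∧ S.HasTriangle A P C

/-- `𝒞` has enough injectives. -/
class HasEnoughInj : Prop where
  exists_triangle : ∀ A : 𝒞, ∃ I C : 𝒞, S.IsInj I ∧ S.HasTriangle A I C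

/-- A syzygy `Ω X`: a chosen object with an `𝔼`-triangle `Ω X ⟶ P ⟶ X ⇢`, `P` projective. -/
noncomputable def syzygy [S.HasEnoughProj] (X : 𝒞) : 𝒞 :=
  (HasEnoughProj.exists_triangle (S := S) X).choose

/-- The `i`-th syzygy `Ωⁱ X`. -/
noncomputable def syzygyIter [S.HasEnoughProj] : ℕ → 𝒞 → 𝒞
  | 0, X => X
  | i + 1, X => S.syzygy (syzygyIter i X)

/-- The higher extension group `𝔼ⁱ⁺¹(X, Y) = 𝔼(Ωⁱ X, Y)`, for `i ≥ 0`; up to isomorphism it does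
not depend on the chosen syzygies. -/
noncomputable def extSucc [S.HasEnoughProj] (i : ℕ) (X Y : 𝒞) : AddCommGrpCat.{w} :=
  (S.E.obj (op (S.syzygyIter i X))).obj Y

/-- `ω^⊥ = {Y | 𝔼ⁱ(X, Y) = 0 for all i ≥ 1 and all X ∈ ω}`. -/
def rightPerp [S.HasEnoughProj] (ω : ObjectProperty 𝒞) : ObjectProperty 𝒞 :=
  fun Y => ∀ X : 𝒞, ω X → ∀ i : ℕ, Subsingleton (S.extSucc i X Y)

/-- `^⊥ω = {Y | 𝔼ⁱ(Y, X) = 0 for all i ≥ 1 and all X ∈ ω}`. -/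
def leftPerp [S.HasEnoughProj] (ω : ObjectProperty 𝒞) : ObjectProperty 𝒞 :=
  fun Y => ∀ X : 𝒞, ω X → ∀ i : ℕ, Subsingleton (S.extSucc i Y X)

/-- `ω` is self-orthogonal: `ω ⊆ ω^⊥`. -/
def IsSelfOrthogonal [S.HasEnoughProj] (ω : ObjectProperty 𝒞) : Prop :=
  ω ≤ S.rightPerp ω

/-- `ω̂ₙ`: objects `A` with an `𝔼`-triangle sequence `Wₙ ⟶ ⋯ ⟶ W₁ ⟶ W₀ ⟶ A`, all `Wᵢ ∈ ω`. Such a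
sequence consists of `𝔼`-triangles `Kᵢ₊₁ ⟶ Wᵢ ⟶ Kᵢ` with `K₀ = A` and `Kₙ = Wₙ`. -/
def hatN (ω : ObjectProperty 𝒞) : ℕ → ObjectProperty 𝒞
  | 0 => ω
  | n + 1 => fun A => ∃ K W : 𝒞, ω W ∧ hatN ω n K ∧ S.HasTriangle K W A

/-- `ω̌ₙ`: objects `A` with an `𝔼`-triangle sequence `A ⟶ W⁰ ⟶ W¹ ⟶ ⋯ ⟶ Wⁿ`, all `Wⁱ ∈ ω`. -/
def checkN (ω : ObjectProperty 𝒞) : ℕ → ObjectProperty 𝒞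
  | 0 => ω
  | n + 1 => fun A => ∃ W K : 𝒞, ω W ∧ checkN ω n K ∧ S.HasTriangle A W K

/-- `ω̂ = ⋃ₙ ω̂ₙ`. -/
def hat (ω : ObjectProperty 𝒞) : ObjectProperty 𝒞 := fun A => ∃ n : ℕ, S.hatN ω n A

/-- `ω̌ = ⋃ₙ ω̌ₙ`. -/
def check (ω : ObjectProperty 𝒞) : ObjectProperty 𝒞 := fun A => ∃ n : ℕ, S.checkN ω n A

/-- `_ω𝒳`: objects `A` with an `𝔼`-triangle sequence `⋯ ⟶ W₂ ⟶ W₁ ⟶ W₀ ⟶ A`, with `𝔼`-triangles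
`Kᵢ₊₁ ⟶ Wᵢ ⟶ Kᵢ`, `K₀ = A`, all `Wᵢ ∈ ω` and all `Kᵢ ∈ ω^⊥`. -/
def leftX [S.HasEnoughProj] (ω : ObjectProperty 𝒞) : ObjectProperty 𝒞 :=
  fun A => ∃ K W : ℕ → 𝒞, K 0 = A ∧
    ∀ i : ℕ, ω (W i) ∧ S.rightPerp ω (K i) ∧ S.HasTriangle (K (i + 1)) (W i) (K i)

/-- `𝒯` is a `𝒟`-tilting subcategory, i.e. `(𝒟, 𝒯)` is a tilting pair (of subcategories). -/
structure IsTilting [S.HasEnoughProj] (D T : ObjectProperty 𝒞) : Prop where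
  subcategory_left : IsSubcategory D
  subcategory_right : IsSubcategory T
  selfOrthogonal_left : S.IsSelfOrthogonal D
  selfOrthogonal_right : S.IsSelfOrthogonal T
  le_hat : T ≤ S.hat D
  le_check : D ≤ S.check T

/-- `I` is a relative injective cogenerator of `Y`. -/
structure IsRelInjCogenerator [S.HasEnoughProj] (I Y : ObjectProperty 𝒞) : Prop where
  subcategory : IsSubcategory I
  le : I ≤ Y ⊓ S.rightPerp Y
  exists_triangle : ∀ A : 𝒞, Y A → ∃ J A' : 𝒞, I J ∧ Y A' ∧ S.HasTriangle A J A'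

/-- `D` is a relative coresolving subcategory of `Y`. -/
structure IsRelCoresolving (D Y : ObjectProperty 𝒞) : Prop where
  subcategory : IsSubcategory D
  le : D ≤ Y
  ext_closed : ∀ A B C : 𝒞, S.HasTriangle A B C → D A → D C → D B
  cone_closed : ∀ A B C : 𝒞, S.HasTriangle A B C → D A → D B → D C
  inj_le : ∀ J : 𝒞, S.IsInjIn Y J → D J

/-- `D` is strongly covariantly finite in `Y`: every `A ∈ Y` has an `𝔼`-triangle
`A -g-> W ⟶ V ⇢` in `Y` with `g` a left `D`-approximation. -/
def IsStronglyCovariantlyFiniteIn (D Y : ObjectProperty 𝒞) : Prop :=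
  ∀ A : 𝒞, Y A → ∃ (W V : 𝒞) (g : A ⟶ W) (h : W ⟶ V), D W ∧ Y V ∧ S.IsConflation g h ∧
    ∀ (W' : 𝒞) (f : A ⟶ W'), D W' → ∃ k : W ⟶ W', g ≫ k = f

/-- `M` has a finite filtration by objects of `F`, i.e. there are `𝔼`-triangles
`Mᵢ₋₁ ⟶ Mᵢ ⟶ Sᵢ ⇢` (`1 ≤ i ≤ n`) with `M₀ = 0`, `Mₙ = M` and all `Sᵢ ∈ F`. -/
inductive HasFiltration (F : Set 𝒞) : 𝒞 → Prop
  | zero (M : 𝒞) (h : IsZero M) : HasFiltration F M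
  | step (M' M X : 𝒞) (h' : HasFiltration F M') (hX : X ∈ F) (h : S.HasTriangle M' M X) :
      HasFiltration F M

/-- `Y` is finitely filtered: for some finite set of objects of `Y`, every object of `Y` has a
finite filtration by this set. -/
def IsFinitelyFiltered (Y : ObjectProperty 𝒞) : Prop :=
  ∃ F : Set 𝒞, F.Finite ∧ (∀ X ∈ F, Y X) ∧ ∀ M : 𝒞, Y M → S.HasFiltration F M

end Extriangulated

/-! ### The extension bifunctor and its two actions. -/

namespace Extriangulated

open scoped ZeroObject

variable {𝒞 : Type u} [Category.{v} 𝒞] [Preadditive 𝒞] [HasZeroObject 𝒞]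
  [HasBinaryBiproducts 𝒞] (S : Extriangulated.{w} 𝒞)

/-! Write X for `leftX C`. Both directions depend on one integer n such that 𝔼^{i+1}(U, M) = 0 for
all i ≥ n, U ∈ T and M ∈ X.

From T to D = T^⊥ ∩ X. If T = add T₀, a finite C-resolution of T₀ gives the bound
(`IsTilting.exists_bound`). Lowering the bound one degree at a time produces triangles M → D₀ → V
with D₀ ∈ D and V ∈ Ť (`IsTilting.exists_bounded_preenvelope`). Since T^⊥ is also orthogonal to Ť,
these are left D-approximations, and they show X ⊆ Ď. Applied to the kernel of a C-cover and pushed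
out, they give every object of D a T-cover with kernel in D, whence `leftX T = D`
(`IsTilting.leftX_eq`). An object of ^⊥D ∩ D is a summand of its T-cover, so T is recovered from D.

From D to T = ^⊥D ∩ D. The Krull–Schmidt property makes an approximation left minimal, (WIC) keeps
it an inflation, and a Wakamatsu argument puts its cone in ^⊥D
(`IsRelCoresolving.exists_special_preenvelope`). Iterating this coresolves X ∩ ^⊥D by T, because
each step shortens a D-coresolution; in particular C ⊆ Ť. The same triangles split for objects of
T^⊥ ∩ X, so T^⊥ ∩ X = D. The finite filtration gives the bound: its finitely many factors have
D-coresolutions of a common length n, and the objects with such coresolutions are closed under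
extensions, so X ⊆ `checkN D n` and therefore T ⊆ Ĉ.

The filtration also makes T finite (`IsRelCoresolving.isFiniteSubcategory`). Covering the factors by
objects of Ť with kernels in D involves only finitely many objects of T. A horseshoe argument
spreads these covers to all filtered objects, and for objects of T they split. -/

/-- The group `E(C, A)` of extensions. -/
abbrev Ext (C A : 𝒞) : Type w := (S.E.obj (op C)).obj A

/-- The map `a_* : E(C, A) → E(C, A')`. -/
def push {A A' C : 𝒞} (a : A ⟶ A') : S.Ext C A →+ S.Ext C A' :=
  ((S.E.obj (op C)).map a).hom

/-- The map `c^* : E(C, A) → E(C', A)`. -/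
def pull {A C C' : 𝒞} (c : C' ⟶ C) : S.Ext C A →+ S.Ext C' A :=
  ((S.E.map c.op).app A).hom

variable {S}

lemma push_id {A C : 𝒞} (δ : S.Ext C A) : S.push (𝟙 A) δ = δ := by
  simp [push]

lemma pull_id {A C : 𝒞} (δ : S.Ext C A) : S.pull (𝟙 C) δ = δ := by
  simp [pull]

lemma push_comp {A A' A'' C : 𝒞} (a : A ⟶ A') (a' : A' ⟶ A'') (δ : S.Ext C A) :
    S.push (a ≫ a') δ = S.push a' (S.push a δ) := by
  simp [push]

lemma pull_comp {A C C' C'' : 𝒞} (c : C'' ⟶ C') (c' : C' ⟶ C) (δ : S.Ext C A) :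
    S.pull (c ≫ c') δ = S.pull c (S.pull c' δ) := by
  simp [pull]

lemma push_pull {A A' C C' : 𝒞} (a : A ⟶ A') (c : C' ⟶ C) (δ : S.Ext C A) :
    S.push a (S.pull c δ) = S.pull c (S.push a δ) :=
  (ConcreteCategory.congr_hom ((S.E.map c.op).naturality a) δ).symm

lemma push_zero {A A' C : 𝒞} (δ : S.Ext C A) : S.push (0 : A ⟶ A') δ = 0 := by
  have := S.additive_right (op C)
  simp [push, Functor.map_zero]

lemma pull_zero {A C C' : 𝒞} (δ : S.Ext C A) : S.pull (0 : C' ⟶ C) δ = 0 := by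
  have := S.additive_left
  simp [pull, Functor.map_zero]

/-- The sequence `A = A ⟶ 0` realizes the zero extension. -/
lemma realizes_id_zero (A : 𝒞) : S.Realizes (𝟙 A) (0 : A ⟶ 0) (0 : S.Ext (0 : 𝒞) A) := by
  refine S.realizes_of_equiv (x := biprod.inl) (y := biprod.snd)
    { hom := biprod.fst, inv := biprod.inl, hom_inv_id := ?_ } (S.realizes_zero A 0) (by simp)
    ((isZero_zero 𝒞).eq_of_tgt _ _)
  exact biprod.hom_ext' _ _ (by simp) ((isZero_zero 𝒞).eq_of_src _ _)

/-- The sequence `0 ⟶ C = C` realizes the zero extension. -/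
lemma realizes_zero_id (C : 𝒞) : S.Realizes (0 : 0 ⟶ C) (𝟙 C) (0 : S.Ext C (0 : 𝒞)) := by
  refine S.realizes_of_equiv (x := biprod.inl) (y := biprod.snd)
    { hom := biprod.snd, inv := biprod.inr, hom_inv_id := ?_ } (S.realizes_zero 0 C)
    ((isZero_zero 𝒞).eq_of_src _ _) (by simp)
  exact biprod.hom_ext' _ _ ((isZero_zero 𝒞).eq_of_src _ _) (by simp)

/-! ### Exact sequences attached to an 𝔼-triangle. -/

section Exactness

variable {A B C Z : 𝒞} {x : A ⟶ B} {y : B ⟶ C} {δ : S.Ext C A}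

lemma comp_eq_zero_of_realizes (h : S.Realizes x y δ) : x ≫ y = 0 := by
  obtain ⟨c, hc, -⟩ := S.et3 (realizes_id_zero A) h (𝟙 A) x (by simp)
  simpa using hc.symm

lemma push_inflation (h : S.Realizes x y δ) : S.push x δ = 0 := by
  obtain ⟨c, -, hc⟩ := S.et3 h (realizes_id_zero B) x (𝟙 B) (by simp)
  exact hc.trans (map_zero (S.pull c))

lemma pull_deflation (h : S.Realizes x y δ) : S.pull y δ = 0 := by
  obtain ⟨a, -, ha⟩ := S.et3_op (realizes_zero_id B) h (𝟙 B) y (by simp)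
  exact ha.symm.trans (map_zero (S.push a))

lemma exists_lift_of_pull_eq_zero (h : S.Realizes x y δ) (f : Z ⟶ C) (hf : S.pull f δ = 0) :
    ∃ g : Z ⟶ B, g ≫ y = f := by
  obtain ⟨b, -, hb⟩ := S.realization (realizes_zero_id Z) h 0 f
    ((map_zero (S.push (0 : 0 ⟶ A))).trans hf.symm)
  exact ⟨b, by simpa using hb.symm⟩

lemma exists_extend_of_push_eq_zero (h : S.Realizes x y δ) (f : A ⟶ Z) (hf : S.push f δ = 0) :
    ∃ g : B ⟶ Z, x ≫ g = f := by
  obtain ⟨b, hb, -⟩ := S.realization h (realizes_id_zero Z) f 0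
    (hf.trans (map_zero (S.pull (0 : C ⟶ 0))).symm)
  exact ⟨b, by simpa using hb⟩

lemma exists_pull_eq_of_push_eq_zero (h : S.Realizes x y δ) (ε : S.Ext Z A)
    (hε : S.push x ε = 0) : ∃ f : Z ⟶ C, S.pull f δ = ε := by
  obtain ⟨M, p, q, hM⟩ := S.exists_realizes ε
  obtain ⟨g, hg⟩ := exists_extend_of_push_eq_zero hM x hε
  obtain ⟨c, -, hc⟩ := S.et3 hM h (𝟙 A) g (by simpa using hg)
  exact ⟨c, hc.symm.trans (push_id ε)⟩

lemma exists_push_eq_of_pull_eq_zero (h : S.Realizes x y δ) (ε : S.Ext C Z)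
    (hε : S.pull y ε = 0) : ∃ f : A ⟶ Z, S.push f δ = ε := by
  obtain ⟨M, p, q, hM⟩ := S.exists_realizes ε
  obtain ⟨g, hg⟩ := exists_lift_of_pull_eq_zero hM y hε
  obtain ⟨a, -, ha⟩ := S.et3_op h hM g (𝟙 C) (by simpa using hg.symm)
  exact ⟨a, ha.trans (pull_id ε)⟩

lemma exists_lift_of_comp_eq_zero (h : S.Realizes x y δ) (g : Z ⟶ B) (hg : g ≫ y = 0) :
    ∃ f : Z ⟶ A, f ≫ x = g := by
  obtain ⟨a, ha, -⟩ := S.et3_op (realizes_id_zero Z) h g 0 (by simp [hg])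
  exact ⟨a, by simpa using ha.symm⟩

/-- The difference u − 1 factors through `x` and is killed by precomposition with `x`, so it squares
to zero and 2 − u inverts u. -/
lemma isIso_of_comp_eq (h : S.Realizes x y δ) (u : B ⟶ B) (h1 : x ≫ u = x) (h2 : u ≫ y = y) :
    IsIso u := by
  obtain ⟨k, hk⟩ := exists_lift_of_comp_eq_zero h (u - 𝟙 B) (by simp [h2])
  have hx : x ≫ (u - 𝟙 B) = 0 := by simp [h1]
  have hsq : (u - 𝟙 B) ≫ (u - 𝟙 B) = 0 := by
    nth_rw 1 [← hk]
    rw [Category.assoc, hx, comp_zero]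
  have hsq' : u ≫ u = u + u - 𝟙 B := by
    simp only [Preadditive.sub_comp, Preadditive.comp_sub, Category.comp_id,
      Category.id_comp] at hsq
    rw [← sub_eq_zero, ← hsq]
    abel
  refine ⟨𝟙 B + 𝟙 B - u, ?_, ?_⟩
  · simp only [Preadditive.comp_sub, Preadditive.comp_add, Category.comp_id, hsq']
    abel
  · simp only [Preadditive.sub_comp, Preadditive.add_comp, Category.id_comp, hsq']
    abel

/-- (ET4) composes `x` with the inflation realizing `ε`; the induced triangle on cones realizes y_*ε
= 0. A section of its deflation pulls the extension of the composite back to the required class. -/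
lemma exists_push_inflation_eq (h : S.Realizes x y δ) (ε : S.Ext Z B) (hε : S.push y ε = 0) :
    ∃ ε' : S.Ext Z A, S.push x ε' = ε := by
  obtain ⟨M, g, g', hM⟩ := S.exists_realizes ε
  obtain ⟨X, d, e, h', δ'', -, -, -, hde, -, hX⟩ := S.et4 h hM
  obtain ⟨s, hs⟩ := exists_lift_of_pull_eq_zero hde (𝟙 Z) (by
    change S.pull (𝟙 Z) (S.push y ε) = 0
    rw [hε, map_zero])
  refine ⟨S.pull s δ'', ?_⟩
  rw [push_pull]
  change S.pull s ((S.E.obj (op X)).map x δ'') = ε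
  rw [hX]
  change S.pull s (S.pull e ε) = ε
  rw [← pull_comp, hs, pull_id]

lemma exists_pull_deflation_eq (h : S.Realizes x y δ) (ε : S.Ext B Z) (hε : S.pull x ε = 0) :
    ∃ ε' : S.Ext C Z, S.pull y ε' = ε := by
  obtain ⟨M, g, g', hM⟩ := S.exists_realizes ε
  obtain ⟨X, d, e, h', δ'', -, -, -, hde, -, hX⟩ := S.et4_op hM h
  obtain ⟨r, hr⟩ := exists_extend_of_push_eq_zero hde (𝟙 Z) (by
    change S.push (𝟙 Z) (S.pull x ε) = 0
    rw [hε, map_zero])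
  refine ⟨S.push r δ'', ?_⟩
  rw [← push_pull]
  change S.push r ((S.E.map y.op).app X δ'') = ε
  rw [← hX]
  change S.push r (S.push d ε) = ε
  rw [← push_comp, hr, push_id]

end Exactness

/-! ### Composition, pullback and pushout of triangles. -/

section Triangles

lemma hasTriangle_of_realizes {A B C : 𝒞} {x : A ⟶ B} {y : B ⟶ C}
    {δ : S.Ext C A} (h : S.Realizes x y δ) : S.HasTriangle A B C := ⟨x, y, δ, h⟩

lemma HasTriangle.iso_middle {A B B' C : 𝒞} (h : S.HasTriangle A B C) (e : B ≅ B') :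
    S.HasTriangle A B' C := by
  obtain ⟨x, y, δ, h⟩ := h
  exact ⟨x ≫ e.hom, e.inv ≫ y, δ, S.realizes_of_equiv e h rfl (by simp)⟩

lemma HasTriangle.iso_ends {A A' B C C' : 𝒞} (h : S.HasTriangle A B C) (a : A ≅ A')
    (c : C ≅ C') : S.HasTriangle A' B C' := by
  obtain ⟨x, y, δ, h⟩ := h
  obtain ⟨B', x', y', h'⟩ := S.exists_realizes (S.push a.hom (S.pull c.inv δ))
  have e1 : S.push a.hom δ = S.pull c.hom (S.push a.hom (S.pull c.inv δ)) := by
    rw [← push_pull, ← pull_comp, c.hom_inv_id, pull_id]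
  have e2 : S.push a.inv (S.push a.hom (S.pull c.inv δ)) = S.pull c.inv δ := by
    rw [← push_comp, a.hom_inv_id, push_id]
  obtain ⟨b, hb, hb'⟩ := S.realization h h' a.hom c.hom e1
  obtain ⟨d, hd, hd'⟩ := S.realization h' h a.inv c.inv e2
  -- The comparison maps are not known to be invertible, but both composites fix the outer maps of a
  -- triangle, so they are isomorphisms.
  have := isIso_of_comp_eq h (b ≫ d) (by rw [reassoc_of% hb, hd, a.hom_inv_id_assoc])
    (by rw [Category.assoc, ← hd', ← reassoc_of% hb', c.hom_inv_id, Category.comp_id])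
  have := isIso_of_comp_eq h' (d ≫ b) (by rw [reassoc_of% hd, hb, a.inv_hom_id_assoc])
    (by rw [Category.assoc, ← hb', ← reassoc_of% hd', c.inv_hom_id, Category.comp_id])
  have : IsIso d := by
    have : IsSplitEpi d := ⟨⟨inv (b ≫ d) ≫ b, by simp⟩⟩
    have : Mono d := mono_of_mono d b
    exact isIso_of_mono_of_isSplitEpi d
  exact HasTriangle.iso_middle ⟨x', y', _, h'⟩ (asIso d)

variable (S) in
lemma hasTriangle_self_zero (A : 𝒞) : S.HasTriangle A A 0 :=
  ⟨_, _, _, realizes_id_zero A⟩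

variable (S) in
lemma hasTriangle_zero_self (A : 𝒞) : S.HasTriangle 0 A A :=
  ⟨_, _, _, realizes_zero_id A⟩

variable (S) in
lemma hasTriangle_biprod (A C : 𝒞) : S.HasTriangle A (A ⊞ C) C :=
  ⟨_, _, _, S.realizes_zero A C⟩

lemma realizes_inr_fst (A C : 𝒞) :
    S.Realizes (biprod.inr : C ⟶ A ⊞ C) (biprod.fst : A ⊞ C ⟶ A) 0 :=
  S.realizes_of_equiv (biprod.braiding C A) (S.realizes_zero C A)
    (by ext <;> simp) (by simp)

/-- Composition of two inflations. -/
lemma HasTriangle.comp_inflation {A B C D F : 𝒞} (h : S.HasTriangle A B D)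
    (h' : S.HasTriangle B C F) : ∃ X, S.HasTriangle D X F ∧ S.HasTriangle A C X := by
  obtain ⟨f, f', δ, h⟩ := h
  obtain ⟨g, g', δ', h'⟩ := h'
  obtain ⟨X, d, e, i, θ, -, -, h1, h2, -, -⟩ := S.et4 h h'
  exact ⟨X, ⟨_, _, _, h2⟩, ⟨_, _, _, h1⟩⟩

/-- Composition of two deflations. -/
lemma HasTriangle.comp_deflation {A B C D F : 𝒞} (h : S.HasTriangle D A B)
    (h' : S.HasTriangle F B C) : ∃ X, S.HasTriangle D X F ∧ S.HasTriangle X A C := by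
  obtain ⟨f, f', δ, h⟩ := h
  obtain ⟨g, g', δ', h'⟩ := h'
  obtain ⟨X, d, e, i, θ, -, -, h1, h2, -, -⟩ := S.et4_op h h'
  exact ⟨X, ⟨_, _, _, h2⟩, ⟨_, _, _, h1⟩⟩

/-- Pullback of two deflations with the same target. -/
lemma HasTriangle.pullback {A B C K W : 𝒞} (h : S.HasTriangle A B C)
    (h' : S.HasTriangle K W C) : ∃ P, S.HasTriangle K P B ∧ S.HasTriangle A P W := by
  obtain ⟨x, y, δ, h⟩ := h
  obtain ⟨k, l, ε, h'⟩ := h'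
  -- The pullback is the middle term of the pair (δ, ε) ∈ 𝔼(C, A ⊞ K): dividing out one summand by
  -- (ET4) leaves a triangle realizing the component on the other.
  obtain ⟨P, p, q, hP⟩ := S.exists_realizes
    (S.push (biprod.inl : A ⟶ A ⊞ K) δ + S.push (biprod.inr : K ⟶ A ⊞ K) ε)
  obtain ⟨X, d, e, i, θ, -, -, h1, h2, -, -⟩ := S.et4 (realizes_inr_fst A K) hP
  obtain ⟨X', d', e', i', θ', -, -, h1', h2', -, -⟩ := S.et4 (S.realizes_zero A K) hP
  have e1 : S.push biprod.fst (S.push (biprod.inl : A ⟶ A ⊞ K) δ +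
      S.push (biprod.inr : K ⟶ A ⊞ K) ε) = δ := by
    rw [map_add, ← push_comp, ← push_comp, biprod.inl_fst, biprod.inr_fst, push_id, push_zero,
      add_zero]
  have e2 : S.push biprod.snd (S.push (biprod.inl : A ⟶ A ⊞ K) δ +
      S.push (biprod.inr : K ⟶ A ⊞ K) ε) = ε := by
    rw [map_add, ← push_comp, ← push_comp, biprod.inl_snd, biprod.inr_snd, push_id, push_zero,
      zero_add]
  replace h2 : S.Realizes d e δ := e1 ▸ h2
  replace h2' : S.Realizes d' e' ε := e2 ▸ h2'
  obtain ⟨b, -, -⟩ := S.realizes_unique h2 h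
  obtain ⟨b', -, -⟩ := S.realizes_unique h2' h'
  exact ⟨P, (hasTriangle_of_realizes h1).iso_ends (Iso.refl _) b,
    (hasTriangle_of_realizes h1').iso_ends (Iso.refl _) b'⟩

/-- Pushout of two inflations with the same source. -/
lemma HasTriangle.pushout {A B C D V : 𝒞} (h : S.HasTriangle A B C)
    (h' : S.HasTriangle A D V) : ∃ Q, S.HasTriangle D Q C ∧ S.HasTriangle B Q V := by
  obtain ⟨x, y, δ, h⟩ := h
  obtain ⟨k, l, ε, h'⟩ := h'
  obtain ⟨P, p, q, hP⟩ := S.exists_realizes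
    (S.pull (biprod.fst : C ⊞ V ⟶ C) δ + S.pull (biprod.snd : C ⊞ V ⟶ V) ε)
  obtain ⟨X, d, e, i, θ, -, -, h1, h2, -, -⟩ := S.et4_op hP (S.realizes_zero C V)
  obtain ⟨X', d', e', i', θ', -, -, h1', h2', -, -⟩ := S.et4_op hP (realizes_inr_fst C V)
  have e1 : S.pull biprod.inl (S.pull (biprod.fst : C ⊞ V ⟶ C) δ +
      S.pull (biprod.snd : C ⊞ V ⟶ V) ε) = δ := by
    rw [map_add, ← pull_comp, ← pull_comp, biprod.inl_fst, biprod.inl_snd, pull_id, pull_zero,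
      add_zero]
  have e2 : S.pull biprod.inr (S.pull (biprod.fst : C ⊞ V ⟶ C) δ +
      S.pull (biprod.snd : C ⊞ V ⟶ V) ε) = ε := by
    rw [map_add, ← pull_comp, ← pull_comp, biprod.inr_fst, biprod.inr_snd, pull_id, pull_zero,
      zero_add]
  replace h2 : S.Realizes d e δ := e1 ▸ h2
  replace h2' : S.Realizes d' e' ε := e2 ▸ h2'
  obtain ⟨b, -, -⟩ := S.realizes_unique h2 h
  obtain ⟨b', -, -⟩ := S.realizes_unique h2' h'
  exact ⟨P, (hasTriangle_of_realizes h1').iso_ends b' (Iso.refl _),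
    (hasTriangle_of_realizes h1).iso_ends b (Iso.refl _)⟩

lemma iso_biprod_of_subsingleton {A B C : 𝒞} (h : S.HasTriangle A B C)
    (h' : Subsingleton (S.Ext C A)) : Nonempty (B ≅ A ⊞ C) := by
  obtain ⟨x, y, δ, h⟩ := h
  obtain rfl : δ = 0 := Subsingleton.elim _ _
  obtain ⟨b, -⟩ := S.realizes_unique h (S.realizes_zero A C)
  exact ⟨b⟩

lemma HasTriangle.flip {A B C : 𝒞} (h : S.HasTriangle A B C)
    (h' : Subsingleton (S.Ext C A)) : S.HasTriangle C B A := by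
  obtain ⟨b⟩ := iso_biprod_of_subsingleton h h'
  exact HasTriangle.iso_middle ⟨_, _, _, realizes_inr_fst A C⟩ b.symm

end Triangles
end Extriangulated

namespace Extriangulated

open scoped ZeroObject

variable {𝒞 : Type u} [Category.{v} 𝒞] [Preadditive 𝒞] [HasZeroObject 𝒞]
  [HasBinaryBiproducts 𝒞] {S : Extriangulated.{w} 𝒞}

/-! ### Vanishing of 𝔼 and dimension shifting by one step. -/

section Vanishing

lemma IsProj.subsingleton_ext {P : 𝒞} (hP : S.IsProj P) (M : 𝒞) : Subsingleton (S.Ext P M) := by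
  refine subsingleton_of_forall_eq 0 fun δ => ?_
  obtain ⟨B, x, y, h⟩ := S.exists_realizes δ
  obtain ⟨s, hs⟩ := hP x y ⟨δ, h⟩ (𝟙 P)
  rw [← pull_id δ, ← hs, pull_comp, pull_deflation h, map_zero]

lemma IsInj.subsingleton_ext {I : 𝒞} (hI : S.IsInj I) (Z : 𝒞) : Subsingleton (S.Ext Z I) := by
  refine subsingleton_of_forall_eq 0 fun δ => ?_
  obtain ⟨B, x, y, h⟩ := S.exists_realizes δ
  obtain ⟨r, hr⟩ := hI x y ⟨δ, h⟩ (𝟙 I)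
  rw [← push_id δ, ← hr, push_comp, push_inflation h, map_zero]

lemma subsingleton_ext_of_retract_right {Z A B : 𝒞} (i : A ⟶ B) (r : B ⟶ A) (h : i ≫ r = 𝟙 A)
    (hB : Subsingleton (S.Ext Z B)) : Subsingleton (S.Ext Z A) := by
  refine subsingleton_of_forall_eq 0 fun δ => ?_
  rw [← push_id δ, ← h, push_comp, Subsingleton.elim (S.push i δ) 0, map_zero]

lemma subsingleton_ext_of_retract_left {M A B : 𝒞} (i : A ⟶ B) (r : B ⟶ A) (h : i ≫ r = 𝟙 A)
    (hB : Subsingleton (S.Ext B M)) : Subsingleton (S.Ext A M) := by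
  refine subsingleton_of_forall_eq 0 fun δ => ?_
  rw [← pull_id δ, ← h, pull_comp, Subsingleton.elim (S.pull r δ) 0, map_zero]

lemma subsingleton_ext_zero_left {Z : 𝒞} (hZ : IsZero Z) (M : 𝒞) : Subsingleton (S.Ext Z M) := by
  refine subsingleton_of_forall_eq 0 fun δ => ?_
  rw [← pull_id δ, hZ.eq_of_src (𝟙 Z) 0, pull_zero]

lemma subsingleton_ext_zero_right {Z : 𝒞} (hZ : IsZero Z) (M : 𝒞) :
    Subsingleton (S.Ext M Z) := by
  refine subsingleton_of_forall_eq 0 fun δ => ?_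
  rw [← push_id δ, hZ.eq_of_src (𝟙 Z) 0, push_zero]

variable {A B C Z N Z' P N' I : 𝒞}

lemma HasTriangle.subsingleton_middle_right (h : S.HasTriangle A B C)
    (hA : Subsingleton (S.Ext Z A)) (hC : Subsingleton (S.Ext Z C)) :
    Subsingleton (S.Ext Z B) := by
  obtain ⟨x, y, δ, h⟩ := h
  refine subsingleton_of_forall_eq 0 fun ε => ?_
  obtain ⟨ε', rfl⟩ := exists_push_inflation_eq h ε (Subsingleton.elim _ _)
  rw [Subsingleton.elim ε' 0, map_zero]

lemma HasTriangle.subsingleton_middle_left (h : S.HasTriangle A B C)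
    (hA : Subsingleton (S.Ext A N)) (hC : Subsingleton (S.Ext C N)) :
    Subsingleton (S.Ext B N) := by
  obtain ⟨x, y, δ, h⟩ := h
  refine subsingleton_of_forall_eq 0 fun ε => ?_
  obtain ⟨ε', rfl⟩ := exists_pull_deflation_eq h ε (Subsingleton.elim _ _)
  rw [Subsingleton.elim ε' 0, map_zero]

/-- Both groups are quotients of Hom(Z', N'), because 𝔼(P, N') and 𝔼(Z', I) vanish. The vanishing of
𝔼(Z, I) and 𝔼(P, N) shows that the two quotients are zero simultaneously. -/
lemma subsingleton_ext_shift (hP : S.IsProj P) (hZ : S.HasTriangle Z' P Z) (hI : S.IsInj I)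
    (hN : S.HasTriangle N I N') : Subsingleton (S.Ext Z' N) ↔ Subsingleton (S.Ext Z N') := by
  obtain ⟨x, y, ε, hZ⟩ := hZ
  obtain ⟨k, l, η, hN⟩ := hN
  have := hP.subsingleton_ext N
  have := hP.subsingleton_ext N'
  have := hI.subsingleton_ext Z
  have := hI.subsingleton_ext Z'
  refine ⟨fun _ => subsingleton_of_forall_eq 0 fun δ => ?_,
    fun _ => subsingleton_of_forall_eq 0 fun δ => ?_⟩
  · obtain ⟨f, rfl⟩ := exists_push_eq_of_pull_eq_zero hZ δ (Subsingleton.elim _ _)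
    obtain ⟨g, rfl⟩ := exists_lift_of_pull_eq_zero hN f (Subsingleton.elim _ _)
    rw [push_comp, Subsingleton.elim (S.push g ε) 0, map_zero]
  · obtain ⟨f, rfl⟩ := exists_pull_eq_of_push_eq_zero hN δ (Subsingleton.elim _ _)
    obtain ⟨g, rfl⟩ := exists_extend_of_push_eq_zero hZ f (Subsingleton.elim _ _)
    rw [pull_comp, Subsingleton.elim (S.pull g η) 0, map_zero]

lemma HasTriangle.subsingleton_cone_right (h : S.HasTriangle A B C) (hP : S.IsProj P)
    (hZ : S.HasTriangle Z' P Z) (hB : Subsingleton (S.Ext Z B))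
    (hA : Subsingleton (S.Ext Z' A)) : Subsingleton (S.Ext Z C) := by
  obtain ⟨a, b, θ, h⟩ := h
  obtain ⟨x, y, ε, hZ⟩ := hZ
  have := hP.subsingleton_ext C
  refine subsingleton_of_forall_eq 0 fun δ => ?_
  obtain ⟨f, rfl⟩ := exists_push_eq_of_pull_eq_zero hZ δ (Subsingleton.elim _ _)
  obtain ⟨g, rfl⟩ := exists_lift_of_pull_eq_zero h f (Subsingleton.elim _ _)
  rw [push_comp, Subsingleton.elim (S.push g ε) 0, map_zero]

lemma HasTriangle.subsingleton_cocone_right (h : S.HasTriangle A B C) (hP : S.IsProj P)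
    (hZ : S.HasTriangle Z' P Z) (hC : Subsingleton (S.Ext Z C))
    (hB : Subsingleton (S.Ext Z' B)) : Subsingleton (S.Ext Z' A) := by
  obtain ⟨a, b, θ, h⟩ := h
  obtain ⟨x, y, ε, hZ⟩ := hZ
  have := hP.subsingleton_ext A
  refine subsingleton_of_forall_eq 0 fun δ => ?_
  obtain ⟨f, rfl⟩ := exists_pull_eq_of_push_eq_zero h δ (Subsingleton.elim _ _)
  obtain ⟨g, rfl⟩ := exists_extend_of_push_eq_zero hZ f (Subsingleton.elim _ _)
  rw [pull_comp, Subsingleton.elim (S.pull g θ) 0, map_zero]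

lemma HasTriangle.subsingleton_cocone_left (h : S.HasTriangle A B C) (hI : S.IsInj I)
    (hN : S.HasTriangle N I N') (hB : Subsingleton (S.Ext B N))
    (hC : Subsingleton (S.Ext C N')) : Subsingleton (S.Ext A N) := by
  obtain ⟨a, b, θ, h⟩ := h
  obtain ⟨k, l, η, hN⟩ := hN
  have := hI.subsingleton_ext A
  refine subsingleton_of_forall_eq 0 fun δ => ?_
  obtain ⟨f, rfl⟩ := exists_pull_eq_of_push_eq_zero hN δ (Subsingleton.elim _ _)
  obtain ⟨g, rfl⟩ := exists_extend_of_push_eq_zero h f (Subsingleton.elim _ _)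
  rw [pull_comp, Subsingleton.elim (S.pull g η) 0, map_zero]

lemma HasTriangle.subsingleton_cone_left (h : S.HasTriangle A B C) (hI : S.IsInj I)
    (hN : S.HasTriangle N I N') (hA : Subsingleton (S.Ext A N))
    (hB : Subsingleton (S.Ext B N')) : Subsingleton (S.Ext C N') := by
  obtain ⟨a, b, θ, h⟩ := h
  obtain ⟨k, l, η, hN⟩ := hN
  have := hI.subsingleton_ext C
  refine subsingleton_of_forall_eq 0 fun δ => ?_
  obtain ⟨f, rfl⟩ := exists_push_eq_of_pull_eq_zero h δ (Subsingleton.elim _ _)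
  obtain ⟨g, rfl⟩ := exists_lift_of_pull_eq_zero hN f (Subsingleton.elim _ _)
  rw [push_comp, Subsingleton.elim (S.push g θ) 0, map_zero]

end Vanishing

/-! ### Higher extension groups in both variables. -/

section HigherExt

variable (S) in
lemma syzygy_spec [S.HasEnoughProj] (X : 𝒞) : ∃ P, S.IsProj P ∧ S.HasTriangle (S.syzygy X) P X :=
  (HasEnoughProj.exists_triangle (S := S) X).choose_spec

variable (S) in
lemma exists_cosyzygy [S.HasEnoughInj] (X : 𝒞) : ∃ Y I, S.IsInj I ∧ S.HasTriangle X I Y := by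
  obtain ⟨I, Y, h⟩ := HasEnoughInj.exists_triangle (S := S) X
  exact ⟨Y, I, h⟩

variable (S) in
/-- A chosen cosyzygy `Σ X`. -/
noncomputable def cosyzygy [S.HasEnoughInj] (X : 𝒞) : 𝒞 := (S.exists_cosyzygy X).choose

variable (S) in
lemma cosyzygy_spec [S.HasEnoughInj] (X : 𝒞) :
    ∃ I, S.IsInj I ∧ S.HasTriangle X I (S.cosyzygy X) :=
  (S.exists_cosyzygy X).choose_spec

variable [S.HasEnoughProj]

/-- Syzygies on the left are traded for cosyzygies on the right. Triangles in the first variable can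
then be treated in degree one, without taking syzygies of a triangle. -/
lemma extSucc_iff [S.HasEnoughInj] (i : ℕ) (Z M : 𝒞) :
    Subsingleton (S.extSucc i Z M) ↔ Subsingleton (S.Ext Z (S.cosyzygy^[i] M)) := by
  induction i generalizing M with
  | zero => exact Iff.rfl
  | succ i ih =>
    obtain ⟨P, hP, hZ⟩ := S.syzygy_spec (S.syzygyIter i Z)
    obtain ⟨I, hI, hM⟩ := S.cosyzygy_spec M
    rw [Function.iterate_succ_apply]
    exact (subsingleton_ext_shift hP hZ hI hM).trans (ih _)

variable {A B C Z N : 𝒞}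

lemma HasTriangle.extSucc_middle_right (h : S.HasTriangle A B C) (i : ℕ)
    (hA : Subsingleton (S.extSucc i Z A)) (hC : Subsingleton (S.extSucc i Z C)) :
    Subsingleton (S.extSucc i Z B) :=
  h.subsingleton_middle_right hA hC

lemma HasTriangle.extSucc_cone_right (h : S.HasTriangle A B C) (i : ℕ)
    (hB : Subsingleton (S.extSucc i Z B)) (hA : Subsingleton (S.extSucc (i + 1) Z A)) :
    Subsingleton (S.extSucc i Z C) := by
  obtain ⟨P, hP, hZ⟩ := S.syzygy_spec (S.syzygyIter i Z)
  exact h.subsingleton_cone_right hP hZ hB hA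

lemma HasTriangle.extSucc_cocone_right (h : S.HasTriangle A B C) (i : ℕ)
    (hC : Subsingleton (S.extSucc i Z C)) (hB : Subsingleton (S.extSucc (i + 1) Z B)) :
    Subsingleton (S.extSucc (i + 1) Z A) := by
  obtain ⟨P, hP, hZ⟩ := S.syzygy_spec (S.syzygyIter i Z)
  exact h.subsingleton_cocone_right hP hZ hC hB

lemma extSucc_of_retract_right (i : ℕ) (f : A ⟶ B) (r : B ⟶ A) (h : f ≫ r = 𝟙 A)
    (hB : Subsingleton (S.extSucc i Z B)) : Subsingleton (S.extSucc i Z A) :=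
  subsingleton_ext_of_retract_right f r h hB

lemma extSucc_zero_right (i : ℕ) (hN : IsZero N) : Subsingleton (S.extSucc i Z N) :=
  subsingleton_ext_zero_right hN _

variable [S.HasEnoughInj]

lemma HasTriangle.extSucc_middle_left (h : S.HasTriangle A B C) (i : ℕ)
    (hA : Subsingleton (S.extSucc i A N)) (hC : Subsingleton (S.extSucc i C N)) :
    Subsingleton (S.extSucc i B N) := by
  rw [extSucc_iff] at *
  exact h.subsingleton_middle_left hA hC

lemma HasTriangle.extSucc_cocone_left (h : S.HasTriangle A B C) (i : ℕ)
    (hB : Subsingleton (S.extSucc i B N)) (hC : Subsingleton (S.extSucc (i + 1) C N)) :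
    Subsingleton (S.extSucc i A N) := by
  obtain ⟨I, hI, hN⟩ := S.cosyzygy_spec (S.cosyzygy^[i] N)
  rw [extSucc_iff] at *
  rw [Function.iterate_succ_apply'] at hC
  exact h.subsingleton_cocone_left hI hN hB hC

lemma HasTriangle.extSucc_cone_left (h : S.HasTriangle A B C) (i : ℕ)
    (hA : Subsingleton (S.extSucc i A N)) (hB : Subsingleton (S.extSucc (i + 1) B N)) :
    Subsingleton (S.extSucc (i + 1) C N) := by
  obtain ⟨I, hI, hN⟩ := S.cosyzygy_spec (S.cosyzygy^[i] N)
  rw [extSucc_iff] at *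
  rw [Function.iterate_succ_apply'] at *
  exact h.subsingleton_cone_left hI hN hA hB

lemma extSucc_of_retract_left (i : ℕ) (f : A ⟶ B) (r : B ⟶ A) (h : f ≫ r = 𝟙 A)
    (hB : Subsingleton (S.extSucc i B N)) : Subsingleton (S.extSucc i A N) := by
  rw [extSucc_iff] at *
  exact subsingleton_ext_of_retract_left f r h hB

lemma extSucc_zero_left (i : ℕ) (hZ : IsZero Z) : Subsingleton (S.extSucc i Z N) := by
  rw [extSucc_iff]
  exact subsingleton_ext_zero_left hZ _

end HigherExt
end Extriangulated

/-! ### Closure conditions and orthogonal classes. -/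

namespace Extriangulated

open scoped ZeroObject

variable {𝒞 : Type u} [Category.{v} 𝒞] [Preadditive 𝒞] [HasZeroObject 𝒞]
  [HasBinaryBiproducts 𝒞] {S : Extriangulated.{w} 𝒞}

variable (S) in
lemma hasTriangle_biprod_self (A C : 𝒞) : S.HasTriangle C (A ⊞ C) A :=
  ⟨_, _, _, realizes_inr_fst A C⟩

lemma HasTriangle.biprod {A B C A' B' C' : 𝒞} (h : S.HasTriangle A B C)
    (h' : S.HasTriangle A' B' C') : S.HasTriangle (A ⊞ A') (B ⊞ B') (C ⊞ C') := by
  obtain ⟨x, y, δ, h⟩ := h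
  obtain ⟨x', y', δ', h'⟩ := h'
  exact ⟨_, _, _, S.realizes_sum h h'⟩

/-- A class of objects is closed under extensions. -/
def ExtClosed (S : Extriangulated.{w} 𝒞) (P : ObjectProperty 𝒞) : Prop :=
  ∀ A B C : 𝒞, S.HasTriangle A B C → P A → P C → P B

/-- A class of objects is closed under cones of inflations. -/
def ConeClosed (S : Extriangulated.{w} 𝒞) (P : ObjectProperty 𝒞) : Prop :=
  ∀ A B C : 𝒞, S.HasTriangle A B C → P A → P B → P C

lemma hasTriangle_of_iso {A B Z : 𝒞} (e : A ≅ B) (hZ : IsZero Z) : S.HasTriangle A B Z :=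
  ((S.hasTriangle_self_zero A).iso_middle e).iso_ends (Iso.refl _) (hZ.iso (isZero_zero 𝒞)).symm

/-- A class containing the zero objects, closed under extensions and summands, is a
subcategory. -/
lemma ExtClosed.isSubcategory {P : ObjectProperty 𝒞} (h : S.ExtClosed P)
    (h0 : ∀ X : 𝒞, IsZero X → P X) (hs : ∀ X Y : 𝒞, P (X ⊞ Y) → P X) : IsSubcategory P where
  zero := h0
  biprod _ _ hX hY := h _ _ _ (S.hasTriangle_biprod _ _) hX hY
  iso _ _ e hX := h _ _ _ (hasTriangle_of_iso e (isZero_zero 𝒞)) hX (h0 _ (isZero_zero 𝒞))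
  summand := hs

lemma _root_.IsSubcategory.summand_right {P : ObjectProperty 𝒞} (hP : IsSubcategory P) (X Y : 𝒞)
    (h : P (X ⊞ Y)) : P Y :=
  hP.summand _ _ (hP.iso _ _ (biprod.braiding X Y) h)

lemma _root_.IsSubcategory.inf {P Q : ObjectProperty 𝒞} (hP : IsSubcategory P)
    (hQ : IsSubcategory Q) : IsSubcategory (P ⊓ Q) where
  zero X h := ⟨hP.zero X h, hQ.zero X h⟩
  biprod X Y hX hY := ⟨hP.biprod X Y hX.1 hY.1, hQ.biprod X Y hX.2 hY.2⟩
  iso X Y e hX := ⟨hP.iso X Y e hX.1, hQ.iso X Y e hX.2⟩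
  summand X Y h := ⟨hP.summand X Y h.1, hQ.summand X Y h.2⟩

/-- In a triangle whose class lies in a vanishing group, the ends are summands of the middle. -/
lemma HasTriangle.ends_of_middle {A B C : 𝒞} (h : S.HasTriangle A B C)
    (h' : Subsingleton (S.Ext C A)) {P : ObjectProperty 𝒞} (hP : IsSubcategory P) (hB : P B) :
    P A ∧ P C := by
  obtain ⟨e⟩ := iso_biprod_of_subsingleton h h'
  have := hP.iso _ _ e hB
  exact ⟨hP.summand _ _ this, hP.summand_right _ _ this⟩

lemma HasTriangle.middle_of_ends {A B C : 𝒞} (h : S.HasTriangle A B C)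
    (h' : Subsingleton (S.Ext C A)) {P : ObjectProperty 𝒞} (hP : IsSubcategory P) (hA : P A)
    (hC : P C) : P B := by
  obtain ⟨e⟩ := iso_biprod_of_subsingleton h h'
  exact hP.iso _ _ e.symm (hP.biprod _ _ hA hC)

section Perp

variable [S.HasEnoughProj] {ω : ObjectProperty 𝒞}

lemma rightPerp_ext {ω : ObjectProperty 𝒞} {X Y : 𝒞} (hY : S.rightPerp ω Y) (hX : ω X) :
    Subsingleton (S.Ext X Y) := hY X hX 0

lemma leftPerp_ext {ω : ObjectProperty 𝒞} {X Y : 𝒞} (hY : S.leftPerp ω Y) (hX : ω X) :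
    Subsingleton (S.Ext Y X) := hY X hX 0

lemma extClosed_rightPerp : S.ExtClosed (S.rightPerp ω) := fun _ _ _ h hA hC X hX i =>
  h.extSucc_middle_right i (hA X hX i) (hC X hX i)

lemma coneClosed_rightPerp : S.ConeClosed (S.rightPerp ω) := fun _ _ _ h hA hB X hX i =>
  h.extSucc_cone_right i (hB X hX i) (hA X hX (i + 1))

lemma isSubcategory_rightPerp : IsSubcategory (S.rightPerp ω) :=
  extClosed_rightPerp.isSubcategory (fun _ h _ _ i => extSucc_zero_right i h)
    fun _ _ h X hX i => extSucc_of_retract_right i biprod.inl biprod.fst (by simp) (h X hX i)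

lemma rightPerp_antitone {ω ω' : ObjectProperty 𝒞} (h : ω ≤ ω') :
    S.rightPerp ω' ≤ S.rightPerp ω := fun _ hA X hX i => hA X (h X hX) i

variable [S.HasEnoughInj]

lemma extClosed_leftPerp : S.ExtClosed (S.leftPerp ω) := fun _ _ _ h hA hC X hX i =>
  h.extSucc_middle_left i (hA X hX i) (hC X hX i)

lemma leftPerp_cocone {A B C : 𝒞} (h : S.HasTriangle A B C) (hB : S.leftPerp ω B)
    (hC : S.leftPerp ω C) : S.leftPerp ω A := fun X hX i =>
  h.extSucc_cocone_left i (hB X hX i) (hC X hX (i + 1))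

lemma isSubcategory_leftPerp : IsSubcategory (S.leftPerp ω) :=
  extClosed_leftPerp.isSubcategory (fun _ h _ _ i => extSucc_zero_left i h)
    fun _ _ h X hX i => extSucc_of_retract_left i biprod.inl biprod.fst (by simp) (h X hX i)

/-- Dimension shifting along a finite coresolution. Vanishing at `A` uses the next degree at `K`, so
the induction carries all degrees together. -/
lemma rightPerp_le_rightPerp_checkN (n : ℕ) : S.rightPerp ω ≤ S.rightPerp (S.checkN ω n) := by
  intro M hM
  induction n with
  | zero => exact hM
  | succ n ih =>
    rintro A ⟨W, K, hW, hK, h⟩ i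
    exact h.extSucc_cocone_left i (hM W hW i) (ih K hK (i + 1))

lemma rightPerp_le_rightPerp_check : S.rightPerp ω ≤ S.rightPerp (S.check ω) := by
  rintro M hM A ⟨n, hA⟩ i
  exact rightPerp_le_rightPerp_checkN n M hM A hA i

end Perp

/-! ### Closure properties of `leftX`. -/

section LeftX

variable [S.HasEnoughProj] {ω : ObjectProperty 𝒞}

lemma leftX_cases {A : 𝒞} (h : S.leftX ω A) :
    S.rightPerp ω A ∧ ∃ K W, ω W ∧ S.leftX ω K ∧ S.HasTriangle K W A := by
  obtain ⟨K, W, rfl, h⟩ := h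
  exact ⟨(h 0).2.1, K 1, W 0, (h 0).1,
    ⟨fun i => K (i + 1), fun i => W (i + 1), rfl, fun i => h (i + 1)⟩, (h 0).2.2⟩

lemma leftX_le_rightPerp : S.leftX ω ≤ S.rightPerp ω := fun _ h => (leftX_cases h).1

/-- Coinduction principle for `leftX`. -/
lemma le_leftX {Q : ObjectProperty 𝒞} (h : ∀ A, Q A → S.rightPerp ω A ∧
    ∃ K W, ω W ∧ Q K ∧ S.HasTriangle K W A) : Q ≤ S.leftX ω := by
  intro A hA
  choose h1 K W hW hK hT using h
  let f : ℕ → {A // Q A} := fun n => Nat.rec ⟨A, hA⟩ (fun _ B => ⟨K B.1 B.2, hK B.1 B.2⟩) n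
  exact ⟨fun i => (f i).1, fun i => W (f i).1 (f i).2, rfl,
    fun i => ⟨hW _ _, h1 _ (f i).2, hT _ _⟩⟩

variable (hω : IsSubcategory ω) (hself : S.IsSelfOrthogonal ω)

include hω hself

lemma le_leftX_self : ω ≤ S.leftX ω :=
  le_leftX fun A hA => ⟨hself A hA, 0, A, hA, hω.zero _ (isZero_zero 𝒞),
    S.hasTriangle_zero_self A⟩

lemma leftX_zero {Z : 𝒞} (hZ : IsZero Z) : S.leftX ω Z :=
  le_leftX_self hω hself _ (hω.zero _ hZ)

/-- A horseshoe argument, run coinductively on the class of all extensions. Over the cover `V` of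
`C` the extension splits because A ∈ ω^⊥; covering the summand `A` by `W` then gives an extension of
`W` by `V`, which is in ω. The new kernel is an extension of `L` by `K`. -/
lemma extClosed_leftX : S.ExtClosed (S.leftX ω) := by
  intro A B C h hA hC
  refine le_leftX (Q := fun B => ∃ A C, S.leftX ω A ∧ S.leftX ω C ∧ S.HasTriangle A B C) ?_ B
    ⟨A, C, hA, hC, h⟩
  rintro B ⟨A, C, hA, hC, h⟩
  refine ⟨extClosed_rightPerp _ _ _ h (leftX_le_rightPerp _ hA) (leftX_le_rightPerp _ hC), ?_⟩
  obtain ⟨hA', K, W, hW, hK, hT⟩ := leftX_cases hA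
  obtain ⟨hC', L, V, hV, hL, hT'⟩ := leftX_cases hC
  obtain ⟨P, hP1, hP2⟩ := h.pullback hT'
  have hP2' := hP2.flip (rightPerp_ext hA' hV)
  obtain ⟨P', hP1', hP2''⟩ := hP2'.pullback hT
  have hPω : ω P' := hP2''.middle_of_ends (rightPerp_ext (hself _ hV) hW) hω hV hW
  obtain ⟨N, hN, hN'⟩ := hP1'.comp_deflation hP1
  exact ⟨N, P', hPω, ⟨K, L, hK, hL, hN⟩, hN'⟩

/-- The composite W → B → C has as kernel an extension of `A` by the old kernel, which is again in
`leftX ω`. The triangle 0 → L → L puts it back into the coinduction class. -/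
lemma coneClosed_leftX : S.ConeClosed (S.leftX ω) := by
  intro A B C h hA hB
  refine le_leftX (Q := fun C => ∃ A B, S.leftX ω A ∧ S.leftX ω B ∧ S.HasTriangle A B C) ?_ C
    ⟨A, B, hA, hB, h⟩
  rintro C ⟨A, B, hA, hB, h⟩
  refine ⟨coneClosed_rightPerp _ _ _ h (leftX_le_rightPerp _ hA) (leftX_le_rightPerp _ hB), ?_⟩
  obtain ⟨hB', K, W, hW, hK, hT⟩ := leftX_cases hB
  obtain ⟨L, hL, hL'⟩ := hT.comp_deflation h
  exact ⟨L, W, hW, ⟨0, L, leftX_zero hω hself (isZero_zero 𝒞),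
    extClosed_leftX hω hself _ _ _ hL hK hA, S.hasTriangle_zero_self L⟩, hL'⟩

lemma isSubcategory_leftX : IsSubcategory (S.leftX ω) := by
  have hext : S.ExtClosed (S.leftX ω) := extClosed_leftX hω hself
  have hiso : ∀ {A B : 𝒞}, (A ≅ B) → S.leftX ω A → S.leftX ω B := fun e hA =>
    hext _ _ _ (hasTriangle_of_iso e (isZero_zero 𝒞)) hA (leftX_zero hω hself (isZero_zero 𝒞))
  refine hext.isSubcategory (fun _ => leftX_zero hω hself) fun A B h => ?_
  refine le_leftX (Q := fun A => ∃ B, S.leftX ω (A ⊞ B)) ?_ A ⟨B, h⟩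
  rintro A ⟨B, h⟩
  refine ⟨isSubcategory_rightPerp.summand _ _ (leftX_le_rightPerp _ h), ?_⟩
  obtain ⟨-, K, W, hW, hK, hT⟩ := leftX_cases h
  obtain ⟨L, hL, hL'⟩ := hT.comp_deflation (S.hasTriangle_biprod_self A B)
  -- The complement of `L` is `A`: L ⊞ A is an extension of B ⊞ A by K ⊞ 0.
  refine ⟨L, W, hW, ⟨A, ?_⟩, hL'⟩
  exact hext _ _ _ (hL.biprod (S.hasTriangle_zero_self A))
    (hext _ _ _ (S.hasTriangle_biprod K 0) hK (leftX_zero hω hself (isZero_zero 𝒞)))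
    (hiso (biprod.braiding A B) h)

lemma hat_le_leftX : S.hat ω ≤ S.leftX ω := by
  rintro A ⟨n, hA⟩
  induction n generalizing A with
  | zero => exact le_leftX_self hω hself A hA
  | succ n ih =>
    obtain ⟨K, W, hW, hK, hT⟩ := hA
    exact coneClosed_leftX hω hself _ _ _ hT (ih _ hK) (le_leftX_self hω hself _ hW)

end LeftX

end Extriangulated

namespace Extriangulated

open scoped ZeroObject

variable {𝒞 : Type u} [Category.{v} 𝒞] [Preadditive 𝒞] [HasZeroObject 𝒞]
  [HasBinaryBiproducts 𝒞] {S : Extriangulated.{w} 𝒞}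

/-! ### Finite coresolutions. -/

section Check

variable {ω : ObjectProperty 𝒞}

lemma checkN_succ_of_checkN (h0 : ω 0) {n : ℕ} : S.checkN ω n ≤ S.checkN ω (n + 1) := by
  induction n with
  | zero => exact fun A hA => ⟨A, 0, hA, h0, S.hasTriangle_self_zero A⟩
  | succ n ih =>
    rintro A ⟨W, K, hW, hK, h⟩
    exact ⟨W, K, hW, ih _ hK, h⟩

lemma checkN_mono (h0 : ω 0) {m n : ℕ} (h : m ≤ n) : S.checkN ω m ≤ S.checkN ω n := by
  induction h with
  | refl => exact le_rfl
  | step _ ih => exact ih.trans (checkN_succ_of_checkN h0)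

lemma checkN_monotone {ω' : ObjectProperty 𝒞} (h : ω ≤ ω') (n : ℕ) :
    S.checkN ω n ≤ S.checkN ω' n := by
  induction n with
  | zero => exact h
  | succ n ih =>
    rintro A ⟨W, K, hW, hK, hT⟩
    exact ⟨W, K, h _ hW, ih _ hK, hT⟩

lemma check_monotone {ω' : ObjectProperty 𝒞} (h : ω ≤ ω') : S.check ω ≤ S.check ω' := by
  rintro A ⟨n, hA⟩
  exact ⟨n, checkN_monotone h n A hA⟩

lemma le_check : ω ≤ S.check ω := fun _ h => ⟨0, h⟩

lemma check_cocone {A W K : 𝒞} (h : S.HasTriangle A W K) (hW : ω W) (hK : S.check ω K) :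
    S.check ω A := by
  obtain ⟨n, hK⟩ := hK
  exact ⟨n + 1, W, K, hW, hK, h⟩

lemma check_cases (h0 : ω 0) {A : 𝒞} (h : S.check ω A) :
    ∃ W K, ω W ∧ S.check ω K ∧ S.HasTriangle A W K := by
  obtain ⟨n, h⟩ := h
  obtain ⟨W, K, hW, hK, hT⟩ := checkN_succ_of_checkN h0 _ h
  exact ⟨W, K, hW, ⟨n, hK⟩, hT⟩

/-- Pushing out along A → I gives an extension of `C` by `I`, which splits by `hvan`. Embedding the
summand `C` into `W` then embeds `B` into an extension of `I` by `W`, with cone an extension of `M`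
by `L`. The subclass ι is ω itself for self-orthogonal classes and the injective cogenerator for
coresolving ones. -/
lemma extClosed_checkN_succ (hext : S.ExtClosed ω) {ι : ObjectProperty 𝒞} (hι : ι ≤ ω) {n : ℕ}
    (hn : S.ExtClosed (S.checkN ω n))
    (hemb : ∀ A, S.checkN ω (n + 1) A → ∃ I L, ι I ∧ S.checkN ω n L ∧ S.HasTriangle A I L)
    (hvan : ∀ A I, S.checkN ω (n + 1) A → ι I → Subsingleton (S.Ext A I)) :
    S.ExtClosed (S.checkN ω (n + 1)) := by
  intro A B C h hA hC
  obtain ⟨I, L, hI, hL, hT⟩ := hemb A hA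
  obtain ⟨Q, hQ1, hQ2⟩ := h.pushout hT
  have hQ1' := hQ1.flip (hvan _ _ hC hI)
  obtain ⟨W, M, hW, hM, hT'⟩ := hC
  obtain ⟨Q', hQ1'', hQ2'⟩ := hQ1'.pushout hT'
  obtain ⟨N, hN, hN'⟩ := hQ2.comp_inflation hQ2'
  exact ⟨Q', N, hext _ _ _ hQ1'' hW (hι _ hI), hn _ _ _ hN hL hM, hN'⟩

lemma extClosed_check_of_checkN (h0 : ω 0) (h : ∀ n, S.ExtClosed (S.checkN ω n)) :
    S.ExtClosed (S.check ω) := by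
  rintro A B C hT ⟨m, hA⟩ ⟨n, hC⟩
  exact ⟨max m n, h _ _ _ _ hT (checkN_mono h0 (le_max_left m n) _ hA)
    (checkN_mono h0 (le_max_right m n) _ hC)⟩

variable [S.HasEnoughProj] [S.HasEnoughInj]

lemma extClosed_check_of_selfOrthogonal (h0 : ω 0)
    (hb : ∀ X Y : 𝒞, ω X → ω Y → ω (X ⊞ Y)) (hiso : ∀ X Y : 𝒞, (X ≅ Y) → ω X → ω Y)
    (hself : S.IsSelfOrthogonal ω) : S.ExtClosed (S.check ω) := by
  have hext : S.ExtClosed ω := by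
    intro A B C h hA hC
    obtain ⟨e⟩ := iso_biprod_of_subsingleton h (rightPerp_ext (hself _ hA) hC)
    exact hiso _ _ e.symm (hb _ _ hA hC)
  refine extClosed_check_of_checkN h0 fun n => ?_
  induction n with
  | zero => exact hext
  | succ n ih =>
    refine extClosed_checkN_succ hext le_rfl ih (fun A hA => ?_) fun A I hA hI => ?_
    · obtain ⟨W, K, hW, hK, hT⟩ := hA
      exact ⟨W, K, hW, hK, hT⟩
    · exact rightPerp_ext (rightPerp_le_rightPerp_check I (hself _ hI)) ⟨n + 1, hA⟩

omit [S.HasEnoughInj] in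
/-- An object of `ω̌ ∩ ω^⊥` lies in `ω`. -/
lemma mem_of_check_of_rightPerp (hω : IsSubcategory ω) (hself : S.IsSelfOrthogonal ω) {A : 𝒞}
    (h : S.check ω A) (h' : S.rightPerp ω A) : ω A := by
  obtain ⟨n, h⟩ := h
  induction n generalizing A with
  | zero => exact h
  | succ n ih =>
    obtain ⟨W, K, hW, hK, hT⟩ := h
    have hK' := ih (coneClosed_rightPerp _ _ _ hT h' (hself _ hW)) hK
    exact (hT.ends_of_middle (rightPerp_ext h' hK') hω hW).1

end Check

/-! ### Relative coresolving subcategories and their coresolutions. -/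

section Coresolving

variable [S.HasEnoughProj] [S.HasEnoughInj] {X D I : ObjectProperty 𝒞}
  (hI : S.IsRelInjCogenerator I X) (hD : S.IsRelCoresolving D X)

omit [S.HasEnoughInj] in
include hI in
lemma IsRelInjCogenerator.isInjIn {J : 𝒞} (hJ : I J) : S.IsInjIn X J := by
  refine ⟨(hI.le _ hJ).1, ?_⟩
  rintro A B C x y - - hC ⟨δ, h⟩ a
  have := rightPerp_ext (hI.le _ hJ).2 hC
  exact exists_extend_of_push_eq_zero h a (Subsingleton.elim _ _)

omit [S.HasEnoughInj] in
include hI in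
/-- Injective objects of `X` are summands of objects of the cogenerator. -/
lemma IsRelInjCogenerator.mem_of_isInjIn {J : 𝒞} (hJ : S.IsInjIn X J) : I J := by
  obtain ⟨J', A', hJ', hA', x, y, δ, h⟩ := hI.exists_triangle J hJ.1
  obtain ⟨r, hr⟩ := hJ.2 x y hJ.1 (hI.le _ hJ').1 hA' ⟨δ, h⟩ (𝟙 J)
  obtain rfl : δ = 0 := by
    rw [← push_id δ, ← hr, push_comp, push_inflation h, map_zero]
  obtain ⟨e, -⟩ := S.realizes_unique h (S.realizes_zero J A')
  exact hI.subcategory.summand _ _ (hI.subcategory.iso _ _ e hJ')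

include hI hD

omit [S.HasEnoughInj] in
lemma IsRelCoresolving.cogenerator_le : I ≤ D := fun _ hJ => hD.inj_le _ (hI.isInjIn hJ)

omit hI [S.HasEnoughProj] [S.HasEnoughInj] in
lemma IsRelCoresolving.zero_mem : D 0 := hD.subcategory.zero _ (isZero_zero 𝒞)

omit [S.HasEnoughInj] in
/-- Each object of `D` has a triangle `A ⟶ J ⟶ A'` with `J ∈ I` and `A' ∈ D`. -/
lemma IsRelCoresolving.exists_triangle {A : 𝒞} (hA : D A) :
    ∃ J A', I J ∧ D A' ∧ S.HasTriangle A J A' := by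
  obtain ⟨J, A', hJ, hA', hT⟩ := hI.exists_triangle A (hD.le _ hA)
  exact ⟨J, A', hJ, hD.cone_closed _ _ _ hT hA (hD.cogenerator_le hI _ hJ), hT⟩

lemma IsRelCoresolving.extClosed_checkN (n : ℕ) : S.ExtClosed (S.checkN D n) := by
  induction n with
  | zero => exact hD.ext_closed
  | succ n ih =>
    refine extClosed_checkN_succ hD.ext_closed (hD.cogenerator_le hI) ih (fun A hA => ?_)
      fun A J hA hJ => ?_
    -- The first term of a D-coresolution may be enlarged to an object of I; the cone then becomes
    -- an extension of an object of D by `K`, covered by the induction hypothesis.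
    · obtain ⟨W, K, hW, hK, hT⟩ := hA
      obtain ⟨J, A', hJ, hA', hT'⟩ := hD.exists_triangle hI hW
      obtain ⟨M, hM, hM'⟩ := hT.comp_inflation hT'
      exact ⟨J, M, hJ, ih _ _ _ hM hK (checkN_mono hD.zero_mem (Nat.zero_le n) _ hA'), hM'⟩
    · exact rightPerp_ext (rightPerp_le_rightPerp_checkN (n + 1) J (hI.le _ hJ).2)
        (checkN_monotone hD.le _ _ hA)

lemma IsRelCoresolving.extClosed_check : S.ExtClosed (S.check D) :=
  extClosed_check_of_checkN hD.zero_mem (hD.extClosed_checkN hI)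

lemma IsRelCoresolving.check_cocone_closed {A B C : 𝒞} (h : S.HasTriangle A B C)
    (hB : S.check D B) (hC : S.check D C) : S.check D A := by
  obtain ⟨W, K, hW, hK, hT⟩ := check_cases hD.zero_mem hB
  obtain ⟨M, hM, hM'⟩ := h.comp_inflation hT
  exact check_cocone hM' hW (hD.extClosed_check hI _ _ _ hM hC hK)

lemma IsRelCoresolving.check_eq (h : X ≤ S.check D) : S.check D = S.check X := by
  refine le_antisymm (check_monotone hD.le) ?_
  rintro A ⟨n, hA⟩
  induction n generalizing A with
  | zero => exact h _ hA
  | succ n ih =>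
    obtain ⟨W, K, hW, hK, hT⟩ := hA
    exact hD.check_cocone_closed hI hT (h _ hW) (ih _ hK)

omit hI [S.HasEnoughProj] [S.HasEnoughInj] in
lemma IsRelCoresolving.checkN_cone {A B C : 𝒞} (h : S.HasTriangle A B C) (hA : D A) {n : ℕ}
    (hB : S.checkN D n B) : S.checkN D n C := by
  cases n with
  | zero => exact hD.cone_closed _ _ _ h hA hB
  | succ n =>
    obtain ⟨W, K, hW, hK, hT⟩ := hB
    obtain ⟨N, hN, hN'⟩ := h.comp_inflation hT
    exact ⟨N, K, hD.cone_closed _ _ _ hN' hA hW, hK, hN⟩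

/-- Any embedding into D with a cone, not just the first step of a given coresolution, shortens the
length by one. The pushout `Q` is an extension of `K` by `B`, hence has length n, and `C` is the
cone of W → Q with W ∈ D. -/
lemma IsRelCoresolving.checkN_of_triangle {A B C : 𝒞} (h : S.HasTriangle A B C) {n : ℕ}
    (hA : S.checkN D (n + 1) A) (hB : D B) : S.checkN D n C := by
  obtain ⟨W, K, hW, hK, hT⟩ := hA
  obtain ⟨Q, hQ, hQ'⟩ := hT.pushout h
  exact hD.checkN_cone hQ' hW
    (hD.extClosed_checkN hI n _ _ _ hQ (checkN_mono hD.zero_mem (Nat.zero_le n) _ hB) hK)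

end Coresolving
end Extriangulated

namespace Extriangulated

open scoped ZeroObject

variable {𝒞 : Type u} [Category.{v} 𝒞] [Preadditive 𝒞] [HasZeroObject 𝒞]
  [HasBinaryBiproducts 𝒞] {S : Extriangulated.{w} 𝒞}

/-! ### From tilting to coresolving subcategories. -/

section Tilting

variable [S.HasEnoughProj] [S.HasEnoughInj] {C T : ObjectProperty 𝒞} (h : S.IsTilting C T)

include h

omit [S.HasEnoughInj] in
lemma IsTilting.le_leftX : T ≤ S.leftX C :=
  h.le_hat.trans (hat_le_leftX h.subcategory_left h.selfOrthogonal_left)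

lemma IsTilting.rightPerp_le : S.rightPerp T ≤ S.rightPerp C :=
  rightPerp_le_rightPerp_check.trans (rightPerp_antitone h.le_check)

lemma IsTilting.extClosed_check : S.ExtClosed (S.check T) :=
  extClosed_check_of_selfOrthogonal (h.subcategory_right.zero _ (isZero_zero 𝒞))
    h.subcategory_right.biprod h.subcategory_right.iso h.selfOrthogonal_right

/-- Coinduction on cones of maps from `leftX T` to `leftX C`. Covering `P` by `W` in C leaves a
kernel that is an extension of `K` by `L`; pulling back the T-cover of `K` exhibits this kernel as
such a cone again. -/
lemma IsTilting.leftX_le : S.leftX T ≤ S.leftX C := by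
  have hext := extClosed_leftX h.subcategory_left h.selfOrthogonal_left
  intro A hA
  refine Extriangulated.le_leftX
    (Q := fun M => ∃ K P, S.leftX T K ∧ S.leftX C P ∧ S.HasTriangle K P M) ?_ A ?_
  · rintro M ⟨K, P, hK, hP, hM⟩
    obtain ⟨hK', K', T', hT', hK'', hTK⟩ := leftX_cases hK
    obtain ⟨hP', L, W, hW, hL, hTP⟩ := leftX_cases hP
    refine ⟨coneClosed_rightPerp _ _ _ hM (h.rightPerp_le _ hK') hP', ?_⟩
    obtain ⟨N, hN, hN'⟩ := hTP.comp_deflation hM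
    obtain ⟨P', hP1, hP2⟩ := hN.pullback hTK
    exact ⟨N, W, hW, ⟨K', P', hK'', hext _ _ _ hP2 hL (h.le_leftX _ hT'), hP1⟩, hN'⟩
  · obtain ⟨-, K, T', hT', hK, hT⟩ := leftX_cases hA
    exact ⟨K, T', hK, h.le_leftX _ hT', hT⟩

/-- Descending induction on the bound. A preenvelope of the kernel `K` of a C-cover of `M` is pushed
out to `Q`, which lies in Ť because C ⊆ Ť. Embedding `Q` into U ∈ T gives a cone D' of D → U that
receives `M`; self-orthogonality of T makes D' one degree better than `D`. -/
lemma IsTilting.exists_bounded_preenvelope {n : ℕ}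
    (hn : ∀ i, n ≤ i → ∀ M, S.leftX C M → ∀ U, T U → Subsingleton (S.extSucc i U M)) {M : 𝒞}
    (hM : S.leftX C M) :
    ∃ D V, (S.rightPerp T ⊓ S.leftX C) D ∧ S.check T V ∧ S.HasTriangle M D V := by
  have hcone := coneClosed_leftX h.subcategory_left h.selfOrthogonal_left
  have h0 : T 0 := h.subcategory_right.zero _ (isZero_zero 𝒞)
  have key : ∀ j, (∀ M, S.leftX C M → ∃ D V, S.leftX C D ∧ S.check T V ∧ S.HasTriangle M D V ∧
      ∀ i, j ≤ i → ∀ U, T U → Subsingleton (S.extSucc i U D)) →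
      ∀ M, S.leftX C M → ∃ D V, S.leftX C D ∧ S.check T V ∧ S.HasTriangle M D V ∧
        ∀ U, T U → ∀ i, Subsingleton (S.extSucc i U D) := by
    intro j
    induction j with
    | zero =>
      intro H M hM
      obtain ⟨D, V, hD, hV, hT, hE⟩ := H M hM
      exact ⟨D, V, hD, hV, hT, fun U hU i => hE i (Nat.zero_le i) U hU⟩
    | succ j ih =>
      refine fun H => ih fun M hM => ?_
      obtain ⟨-, K, W, hW, hK, hT⟩ := leftX_cases hM
      obtain ⟨D, V, hD, hV, hT', hE⟩ := H K hK
      obtain ⟨Q, hQ, hQ'⟩ := hT.pushout hT'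
      have hQT : S.check T Q := h.extClosed_check _ _ _ hQ' (h.le_check _ hW) hV
      obtain ⟨U, Q', hU, hQ1, hT''⟩ := check_cases h0 hQT
      obtain ⟨D', hD', hD''⟩ := hQ.comp_inflation hT''
      refine ⟨D', Q', hcone _ _ _ hD'' hD (h.le_leftX _ hU), hQ1, hD', fun i hi U' hU' => ?_⟩
      exact hD''.extSucc_cone_right i (h.selfOrthogonal_right _ hU U' hU' i)
        (hE (i + 1) (by omega) U' hU')
  obtain ⟨D, V, hD, hV, hT, hE⟩ := key n (fun M hM => ⟨M, 0, hM, ⟨0, h0⟩,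
    S.hasTriangle_self_zero M, fun i hi U hU => hn i hi M hM U hU⟩) M hM
  exact ⟨D, V, ⟨hE, hD⟩, hV, hT⟩

lemma IsTilting.leftX_eq {n : ℕ}
    (hn : ∀ i, n ≤ i → ∀ M, S.leftX C M → ∀ U, T U → Subsingleton (S.extSucc i U M)) :
    S.leftX T = S.rightPerp T ⊓ S.leftX C := by
  refine le_antisymm (le_inf leftX_le_rightPerp h.leftX_le) (Extriangulated.le_leftX ?_)
  rintro A ⟨hA, hA'⟩
  refine ⟨hA, ?_⟩
  obtain ⟨-, K, W, hW, hK, hT⟩ := leftX_cases hA'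
  obtain ⟨D, V, hD, hV, hT'⟩ := h.exists_bounded_preenvelope hn hK
  obtain ⟨Q, hQ, hQ'⟩ := hT.pushout hT'
  exact ⟨D, Q, mem_of_check_of_rightPerp h.subcategory_right h.selfOrthogonal_right
    (h.extClosed_check _ _ _ hQ' (h.le_check _ hW) hV)
    (extClosed_rightPerp _ _ _ hQ hD.1 hA), hD, hQ⟩

omit h [S.HasEnoughInj] in
lemma le_leftPerp_rightPerp_inf : T ≤ S.leftPerp (S.rightPerp T ⊓ S.leftX C) :=
  fun U hU _ hM i => hM.1 U hU i

omit [S.HasEnoughInj] in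
lemma IsTilting.le_rightPerp_inf : T ≤ S.rightPerp T ⊓ S.leftX C :=
  le_inf h.selfOrthogonal_right h.le_leftX

lemma IsTilting.leftPerp_inf_eq {n : ℕ}
    (hn : ∀ i, n ≤ i → ∀ M, S.leftX C M → ∀ U, T U → Subsingleton (S.extSucc i U M)) :
    S.leftPerp (S.rightPerp T ⊓ S.leftX C) ⊓ (S.rightPerp T ⊓ S.leftX C) = T := by
  refine le_antisymm ?_ (le_inf le_leftPerp_rightPerp_inf h.le_rightPerp_inf)
  rintro A ⟨hA, hA'⟩
  rw [← h.leftX_eq hn] at hA hA'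
  obtain ⟨-, K, W, hW, hK, hT⟩ := leftX_cases hA'
  exact (hT.ends_of_middle (leftPerp_ext hA hK) h.subcategory_right hW).2

omit [S.HasEnoughInj] in
lemma IsTilting.isRelCoresolving {I : ObjectProperty 𝒞} (hI : S.IsRelInjCogenerator I (S.leftX C)) :
    S.IsRelCoresolving (S.rightPerp T ⊓ S.leftX C) (S.leftX C) where
  subcategory := isSubcategory_rightPerp.inf
    (isSubcategory_leftX h.subcategory_left h.selfOrthogonal_left)
  le := inf_le_right
  ext_closed _ _ _ hT hA hB := ⟨extClosed_rightPerp _ _ _ hT hA.1 hB.1,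
    extClosed_leftX h.subcategory_left h.selfOrthogonal_left _ _ _ hT hA.2 hB.2⟩
  cone_closed _ _ _ hT hA hB := ⟨coneClosed_rightPerp _ _ _ hT hA.1 hB.1,
    coneClosed_leftX h.subcategory_left h.selfOrthogonal_left _ _ _ hT hA.2 hB.2⟩
  -- Injectives of `leftX C` belong to the cogenerator, which is right orthogonal to all of `leftX
  -- C` and so to T.
  inj_le _ hJ := ⟨rightPerp_antitone h.le_leftX _ (hI.le _ (hI.mem_of_isInjIn hJ)).2, hJ.1⟩

lemma IsTilting.isStronglyCovariantlyFiniteIn {n : ℕ}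
    (hn : ∀ i, n ≤ i → ∀ M, S.leftX C M → ∀ U, T U → Subsingleton (S.extSucc i U M)) :
    S.IsStronglyCovariantlyFiniteIn (S.rightPerp T ⊓ S.leftX C) (S.leftX C) := by
  intro A hA
  obtain ⟨D, V, hD, hV, g, k, δ, hT⟩ := h.exists_bounded_preenvelope hn hA
  refine ⟨D, V, g, k, hD, coneClosed_leftX h.subcategory_left h.selfOrthogonal_left _ _ _
    ⟨_, _, _, hT⟩ hA hD.2, ⟨δ, hT⟩, fun W' f hW' => ?_⟩
  have := rightPerp_ext (rightPerp_le_rightPerp_check _ hW'.1) hV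
  exact exists_extend_of_push_eq_zero hT f (Subsingleton.elim _ _)

lemma IsTilting.check_eq {I : ObjectProperty 𝒞} (hI : S.IsRelInjCogenerator I (S.leftX C)) {n : ℕ}
    (hn : ∀ i, n ≤ i → ∀ M, S.leftX C M → ∀ U, T U → Subsingleton (S.extSucc i U M)) :
    S.check (S.rightPerp T ⊓ S.leftX C) = S.check (S.leftX C) := by
  refine (h.isRelCoresolving hI).check_eq hI fun A hA => ?_
  obtain ⟨D, V, hD, hV, hT⟩ := h.exists_bounded_preenvelope hn hA
  exact check_cocone hT hD (check_monotone h.le_rightPerp_inf _ hV)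

end Tilting

section Finite

variable [S.HasEnoughProj] [S.HasEnoughInj]

lemma hatN_bound {C : ObjectProperty 𝒞} {n : ℕ} {A : 𝒞} (hA : S.hatN C n A) {M : 𝒞}
    (hM : S.rightPerp C M) {i : ℕ} (hi : n ≤ i) : Subsingleton (S.extSucc i A M) := by
  induction n generalizing A i with
  | zero => exact hM A hA i
  | succ n ih =>
    obtain ⟨K, W, hW, hK, hT⟩ := hA
    obtain ⟨i, rfl⟩ : ∃ j, i = j + 1 := ⟨i - 1, by omega⟩
    exact hT.extSucc_cone_left i (ih hK (by omega)) (hM W hW (i + 1))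

end Finite
end Extriangulated

/-! ### The radical, and left minimal morphisms. -/

section Preadditive

open scoped ZeroObject

variable {𝒞 : Type u} [Category.{v} 𝒞] [Preadditive 𝒞]

/-- `f : X ⟶ Y` lies in the Jacobson radical of the category. -/
def InRadical {X Y : 𝒞} (f : X ⟶ Y) : Prop := ∀ g : Y ⟶ X, IsIso (𝟙 X - f ≫ g)

lemma isIso_id_sub_comp_comm {X Y : 𝒞} (f : X ⟶ Y) (g : Y ⟶ X) (h : IsIso (𝟙 X - f ≫ g)) :
    IsIso (𝟙 Y - g ≫ f) := by
  obtain ⟨u, h1, h2⟩ := h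
  have h1' : f ≫ g ≫ u = u - 𝟙 X := by
    rw [Preadditive.sub_comp, Category.id_comp, Category.assoc] at h1
    rw [← h1]; abel
  have h2' : u ≫ f ≫ g = u - 𝟙 X := by
    rw [Preadditive.comp_sub, Category.comp_id] at h2
    rw [← h2]; abel
  refine ⟨𝟙 Y + g ≫ u ≫ f, ?_, ?_⟩
  · simp only [Preadditive.sub_comp, Preadditive.comp_add, Category.id_comp, Category.comp_id,
      Category.assoc, reassoc_of% h1', Preadditive.comp_sub]
    abel
  · simp only [Preadditive.comp_sub, Preadditive.add_comp, Category.id_comp, Category.comp_id,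
      Category.assoc]
    have : g ≫ u ≫ f ≫ g ≫ f = g ≫ u ≫ f - g ≫ f := by
      rw [← Category.assoc f, ← Category.assoc u, h2']
      simp
    rw [this]
    abel

lemma InRadical.zero (X Y : 𝒞) : InRadical (0 : X ⟶ Y) := fun g => by
  simp only [zero_comp, sub_zero]
  infer_instance

lemma InRadical.comp_right {X Y Z : 𝒞} {f : X ⟶ Y} (hf : InRadical f) (h : Y ⟶ Z) :
    InRadical (f ≫ h) := fun g => by
  rw [Category.assoc]
  exact hf _

lemma InRadical.comp_left {W X Y : 𝒞} {f : X ⟶ Y} (hf : InRadical f) (h : W ⟶ X) :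
    InRadical (h ≫ f) := fun g => by
  rw [Category.assoc]
  apply isIso_id_sub_comp_comm
  rw [Category.assoc]
  exact hf _

lemma InRadical.add {X Y : 𝒞} {f f' : X ⟶ Y} (hf : InRadical f) (hf' : InRadical f') :
    InRadical (f + f') := fun g => by
  have := hf g
  have := hf'.comp_left (inv (𝟙 X - f ≫ g)) g
  have e : 𝟙 X - (f + f') ≫ g =
      (𝟙 X - f ≫ g) ≫ (𝟙 X - (inv (𝟙 X - f ≫ g) ≫ f') ≫ g) := by
    rw [Preadditive.comp_sub, Category.comp_id, Category.assoc, IsIso.hom_inv_id_assoc,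
      Preadditive.add_comp]
    abel
  rw [e]
  infer_instance

lemma InRadical.sum {X Y : 𝒞} {ι : Type*} (s : Finset ι) (f : ι → (X ⟶ Y))
    (h : ∀ i ∈ s, InRadical (f i)) : InRadical (∑ i ∈ s, f i) :=
  Finset.sum_induction f InRadical (fun _ _ => InRadical.add) (InRadical.zero X Y) h

/-- If 𝟙 − f ≫ g is not invertible, locality makes f ≫ g invertible, so `f` has a retraction `s`. In
the local ring End Y, either s ≫ f is a unit and `f` is an isomorphism, or its complement is a unit
and `f` = 0, contradicting 1 ≠ 0 in End X. -/
lemma inRadical_of_not_isIso {X Y : 𝒞} [IsLocalRing (End X)] [IsLocalRing (End Y)] {f : X ⟶ Y}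
    (hf : ¬ IsIso f) : InRadical f := by
  intro g
  by_contra hg
  have h1 := sub_add_cancel (1 : End X) (show End X from f ≫ g)
  have hu : IsIso (f ≫ g) := by
    rcases IsLocalRing.isUnit_or_isUnit_of_add_one h1 with h | h
    · exact absurd ((isUnit_iff_isIso _).1 h) hg
    · exact (isUnit_iff_isIso _).1 h
  obtain ⟨s, hs⟩ : ∃ s : Y ⟶ X, f ≫ s = 𝟙 X :=
    ⟨g ≫ inv (f ≫ g), by rw [← Category.assoc, IsIso.hom_inv_id]⟩
  have h2 := sub_add_cancel (1 : End Y) (show End Y from s ≫ f)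
  rcases IsLocalRing.isUnit_or_isUnit_of_add_one h2 with h | h
  · have := (isUnit_iff_isIso _).1 h
    have h0 : f ≫ (𝟙 Y - s ≫ f) = 0 := by
      rw [Preadditive.comp_sub, Category.comp_id, reassoc_of% hs, sub_self]
    have hf0 : f = 0 := by
      rw [← cancel_mono (𝟙 Y - s ≫ f), h0, zero_comp]
    have : (1 : End X) = 0 := by
      change 𝟙 X = 0
      rw [← hs, hf0, zero_comp]
    exact one_ne_zero this
  · have := (isUnit_iff_isIso _).1 h
    exact hf ⟨s, hs, by
      rw [← cancel_mono (s ≫ f), Category.assoc, reassoc_of% hs, Category.id_comp]⟩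

variable [HasFiniteBiproducts 𝒞]

lemma inRadical_of_components {n m : ℕ} {X : Fin n → 𝒞} {Y : Fin m → 𝒞} (f : ⨁ X ⟶ ⨁ Y)
    (h : ∀ i j, InRadical (biproduct.ι X i ≫ f ≫ biproduct.π Y j)) : InRadical f := by
  have e : f = ∑ i, ∑ j, (biproduct.π X i ≫ (biproduct.ι X i ≫ f ≫ biproduct.π Y j)) ≫
      biproduct.ι Y j := by
    simp only [Category.assoc, ← Preadditive.comp_sum, biproduct.total, Category.comp_id]
    simp only [← Category.assoc, ← Preadditive.sum_comp, biproduct.total, Category.id_comp]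
  rw [e]
  exact InRadical.sum _ _ fun i _ => InRadical.sum _ _ fun j _ =>
    ((h i j).comp_left _).comp_right _

/-- Splitting off one summand of a finite biproduct. -/
noncomputable def biproductSplitIso [HasBinaryBiproducts 𝒞] {n : ℕ} (X : Fin (n + 1) → 𝒞)
    (i : Fin (n + 1)) : ⨁ X ≅ X i ⊞ ⨁ (fun k => X (i.succAbove k)) where
  hom := biprod.lift (biproduct.π X i) (biproduct.lift fun k => biproduct.π X (i.succAbove k))
  inv := biprod.desc (biproduct.ι X i) (biproduct.desc fun k => biproduct.ι X (i.succAbove k))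
  hom_inv_id := by
    rw [biprod.lift_desc, biproduct.lift_desc, ← biproduct.total, Fin.sum_univ_succAbove _ i]
  inv_hom_id := by
    ext k l
    · simp
    · simp [biproduct.ι_π_ne _ (Fin.succAbove_ne i _).symm]
    · simp [biproduct.ι_π_ne _ (Fin.succAbove_ne i _)]
    · by_cases hkl : k = l
      · subst hkl; simp
      · simp [biproduct.ι_π_ne _ hkl,
          biproduct.ι_π_ne _ (fun hh => hkl (Fin.succAbove_right_injective hh))]

variable [HasBinaryBiproducts 𝒞]

omit [HasFiniteBiproducts 𝒞] in
/-- If `q : D ⟶ Y` is a retraction of the inclusion of `Y` into `D = Y ⊕ R`, then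
`D = R ⊕ Y` with second projection `q`. -/
lemma exists_iso_biprod_snd {D Y R : 𝒞} (e : D ≅ Y ⊞ R) (q : D ⟶ Y)
    (hq : biprod.inl ≫ e.inv ≫ q = 𝟙 Y) : ∃ e' : D ≅ R ⊞ Y, e'.hom ≫ biprod.snd = q := by
  have hD : e.hom ≫ biprod.snd ≫ biprod.inr ≫ e.inv =
      𝟙 D - e.hom ≫ biprod.fst ≫ biprod.inl ≫ e.inv := by
    rw [eq_sub_iff_add_eq, ← Preadditive.comp_add, ← Category.assoc, ← Category.assoc,
      ← Preadditive.add_comp, add_comm, biprod.total, Category.id_comp, e.hom_inv_id]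
  refine ⟨⟨biprod.lift (e.hom ≫ biprod.snd) q,
    biprod.desc (biprod.inr ≫ e.inv - biprod.inr ≫ e.inv ≫ q ≫ biprod.inl ≫ e.inv)
      (biprod.inl ≫ e.inv), ?_, ?_⟩, by simp⟩
  · have hD' := congrArg (fun t => t ≫ q ≫ biprod.inl ≫ e.inv) hD
    simp only [Category.assoc, Preadditive.sub_comp, Category.id_comp, reassoc_of% hq] at hD'
    rw [biprod.lift_desc, Preadditive.comp_sub]
    simp only [Category.assoc]
    rw [hD, hD']
    abel
  · ext <;> simp [hq]

/-- Every morphism into a finite direct sum of objects with local endomorphism rings becomes left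
minimal after splitting off a summand on which it vanishes. -/
lemma exists_minimal_decomposition {A : 𝒞} {n : ℕ} (Y : Fin n → 𝒞)
    (hY : ∀ i, IsLocalRing (End (Y i))) {D : 𝒞} (e : D ≅ ⨁ Y) (f : A ⟶ D) :
    ∃ (D' D'' : 𝒞) (e' : D ≅ D' ⊞ D''), f ≫ e'.hom ≫ biprod.snd = 0 ∧
      ∀ ψ : D' ⟶ D', (f ≫ e'.hom ≫ biprod.fst) ≫ ψ = 0 → IsIso (𝟙 D' - ψ) := by
  have base : ∀ {D : 𝒞} (f : A ⟶ D), (∀ ψ : D ⟶ D, f ≫ ψ = 0 → IsIso (𝟙 D - ψ)) →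
      ∃ (D' D'' : 𝒞) (e' : D ≅ D' ⊞ D''), f ≫ e'.hom ≫ biprod.snd = 0 ∧
        ∀ ψ : D' ⟶ D', (f ≫ e'.hom ≫ biprod.fst) ≫ ψ = 0 → IsIso (𝟙 D' - ψ) := by
    intro D f h
    refine ⟨D, 0, ⟨biprod.inl, biprod.fst, by simp, ?_⟩, by simp, fun ψ hψ => h ψ (by simpa using hψ)⟩
    exact biprod.hom_ext' _ _ (by simp) ((isZero_zero 𝒞).eq_of_src _ _)
  induction n generalizing D with
  | zero =>
    refine base f fun ψ _ => ?_
    have hψ : ψ = 0 := by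
      rw [← cancel_mono e.hom]
      ext i
      exact i.elim0
    rw [hψ, sub_zero]
    infer_instance
  | succ n ih =>
    by_cases hmin : ∀ ψ : D ⟶ D, f ≫ ψ = 0 → IsIso (𝟙 D - ψ)
    · exact base f hmin
    push Not at hmin
    obtain ⟨ψ, hψ, hiso⟩ := hmin
    -- If no component of ψ were invertible, ψ would be radical and 𝟙 − ψ an isomorphism.
    obtain ⟨i, j, hij⟩ : ∃ i j, IsIso (biproduct.ι Y i ≫ e.inv ≫ ψ ≫ e.hom ≫ biproduct.π Y j) := by
      by_contra! hno
      have hrad : InRadical (e.inv ≫ ψ ≫ e.hom) := inRadical_of_components _ fun i j =>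
        have := hY i
        have := hY j
        inRadical_of_not_isIso (by simpa using hno i j)
      apply hiso
      have := (hrad.comp_left e.hom).comp_right e.inv (𝟙 D)
      simpa using this
    -- The rescaled component is a retraction onto Y i that factors through ψ, so it kills `f`; the
    -- summand Y i can be discarded.
    obtain ⟨e', he'⟩ := exists_iso_biprod_snd (e ≪≫ biproductSplitIso Y i)
      (ψ ≫ e.hom ≫ biproduct.π Y j ≫
        inv (biproduct.ι Y i ≫ e.inv ≫ ψ ≫ e.hom ≫ biproduct.π Y j)) (by
        have := IsIso.hom_inv_id (biproduct.ι Y i ≫ e.inv ≫ ψ ≫ e.hom ≫ biproduct.π Y j)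
        simp only [Category.assoc] at this
        simp only [biproductSplitIso, Iso.trans_inv, biprod.inl_desc_assoc, Category.assoc]
        exact this)
    obtain ⟨R', R'', a, ha, ha'⟩ := ih (fun k => Y (i.succAbove k)) (fun k => hY _) (Iso.refl _)
      (f ≫ e'.hom ≫ biprod.fst)
    refine ⟨R', R'' ⊞ Y i, e' ≪≫ biprod.mapIso a (Iso.refl _) ≪≫ biprod.associator _ _ _, ?_, ?_⟩
    · have hf : f ≫ e'.hom ≫ biprod.snd = 0 := by rw [he', reassoc_of% hψ, zero_comp]
      ext
      · simpa using ha
      · simpa using hf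
    · intro θ hθ
      exact ha' θ (by simpa using hθ)

end Preadditive

/-! ### Additive closures of a single object. -/

section AddClosure

variable {𝒞 : Type u} [Category.{v} 𝒞] [Preadditive 𝒞] [HasZeroObject 𝒞]
  [HasBinaryBiproducts 𝒞] [HasFiniteBiproducts 𝒞]

lemma IsSubcategory.biproduct_const {P : ObjectProperty 𝒞} (hP : IsSubcategory P) {T : 𝒞}
    (hT : P T) (n : ℕ) : P (⨁ (fun _ : Fin n => T)) := by
  induction n with
  | zero =>
    refine hP.zero _ ((IsZero.iff_id_eq_zero _).2 ?_)
    ext i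
    exact i.elim0
  | succ n ih =>
    exact hP.iso _ _ (biproductSplitIso (fun _ : Fin (n + 1) => T) 0).symm
      (hP.biprod _ _ hT ih)

lemma addClosure_le {P : ObjectProperty 𝒞} (hP : IsSubcategory P) {T : 𝒞} (hT : P T) :
    addClosure T ≤ P := by
  rintro X ⟨n, Y, ⟨e⟩⟩
  exact hP.summand _ _ (hP.iso _ _ e.symm (hP.biproduct_const hT n))

omit [HasZeroObject 𝒞] in
lemma nonempty_biproduct_const_add (T : 𝒞) (n m : ℕ) :
    Nonempty ((⨁ (fun _ : Fin n => T)) ⊞ (⨁ (fun _ : Fin m => T)) ≅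
      ⨁ (fun _ : Fin (n + m) => T)) := by
  induction n with
  | zero =>
    have h0 : IsZero (⨁ (fun _ : Fin 0 => T)) := (IsZero.iff_id_eq_zero _).2 (by
      ext i
      exact i.elim0)
    refine ⟨⟨biprod.snd, biprod.inr, ?_, by simp⟩ ≪≫
      eqToIso (by rw [Nat.zero_add])⟩
    exact biprod.hom_ext' _ _ (h0.eq_of_src _ _) (by simp)
  | succ n ih =>
    obtain ⟨e⟩ := ih
    exact ⟨biprod.mapIso (biproductSplitIso (fun _ : Fin (n + 1) => T) 0) (Iso.refl _) ≪≫
      biprod.associator _ _ _ ≪≫ biprod.mapIso (Iso.refl _) e ≪≫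
      (biproductSplitIso (fun _ : Fin (n + m + 1) => T) 0).symm ≪≫
      eqToIso (by rw [Nat.add_right_comm])⟩

lemma isSubcategory_addClosure (T : 𝒞) : IsSubcategory (addClosure T) where
  zero X hX := by
    refine ⟨0, ⨁ (fun _ : Fin 0 => T), ⟨⟨biprod.snd, biprod.inr, ?_, by simp⟩⟩⟩
    exact biprod.hom_ext' _ _ (hX.eq_of_src _ _) (by simp)
  biprod := by
    rintro X X' ⟨n, Y, ⟨e⟩⟩ ⟨m, Y', ⟨e'⟩⟩
    obtain ⟨a⟩ := nonempty_biproduct_const_add T n m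
    refine ⟨n + m, Y ⊞ Y', ⟨?_ ≪≫ biprod.mapIso e e' ≪≫ a⟩⟩
    exact biprod.associator _ _ _ ≪≫ biprod.mapIso (Iso.refl _)
      ((biprod.associator _ _ _).symm ≪≫ biprod.mapIso (biprod.braiding _ _) (Iso.refl _) ≪≫
        biprod.associator _ _ _) ≪≫ (biprod.associator _ _ _).symm
  iso := by
    rintro X X' a ⟨n, Y, ⟨e⟩⟩
    exact ⟨n, Y, ⟨biprod.mapIso a.symm (Iso.refl _) ≪≫ e⟩⟩
  summand := by
    rintro X X' ⟨n, Y, ⟨e⟩⟩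
    exact ⟨n, X' ⊞ Y, ⟨(biprod.associator _ _ _).symm ≪≫ e⟩⟩

lemma mem_addClosure_self (T : 𝒞) : addClosure T T :=
  ⟨1, ⨁ (fun _ : Fin 0 => T), ⟨(biproductSplitIso (fun _ : Fin 1 => T) 0).symm⟩⟩

lemma addClosure_le_addClosure_biprod_left (T T' : 𝒞) : addClosure T ≤ addClosure (T ⊞ T') :=
  addClosure_le (isSubcategory_addClosure _)
    ((isSubcategory_addClosure _).summand _ _ (mem_addClosure_self (T ⊞ T')))

lemma addClosure_le_addClosure_biprod_right (T T' : 𝒞) : addClosure T' ≤ addClosure (T ⊞ T') :=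
  addClosure_le (isSubcategory_addClosure _)
    ((isSubcategory_addClosure _).summand_right _ _ (mem_addClosure_self (T ⊞ T')))

end AddClosure

namespace Extriangulated

open scoped ZeroObject

variable {𝒞 : Type u} [Category.{v} 𝒞] [Preadditive 𝒞] [HasZeroObject 𝒞]
  [HasBinaryBiproducts 𝒞] {S : Extriangulated.{w} 𝒞}

/-! ### Uniform bounds on extension degrees. -/

section Bounds

variable [S.HasEnoughProj] [S.HasEnoughInj]

lemma IsTilting.exists_bound [HasFiniteBiproducts 𝒞] {C T : ObjectProperty 𝒞}
    (h : S.IsTilting C T) (hT : IsFiniteSubcategory T) :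
    ∃ n, ∀ i, n ≤ i → ∀ M, S.leftX C M → ∀ U, T U → Subsingleton (S.extSucc i U M) := by
  obtain ⟨T₀, rfl⟩ := hT
  obtain ⟨n, hn⟩ := h.le_hat _ (mem_addClosure_self T₀)
  refine ⟨n, fun i hi M hM => ?_⟩
  have hP : IsSubcategory (fun U : 𝒞 => Subsingleton (S.extSucc i U M)) :=
    { zero := fun X hX => extSucc_zero_left i hX
      biprod := fun X Y hX hY => (S.hasTriangle_biprod X Y).extSucc_middle_left i hX hY
      iso := fun X Y e hX => extSucc_of_retract_left i e.inv e.hom (by simp) hX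
      summand := fun X Y hX => extSucc_of_retract_left i biprod.inl biprod.fst (by simp) hX }
  exact addClosure_le hP (hatN_bound hn (leftX_le_rightPerp _ hM) hi)

omit [S.HasEnoughInj] in
lemma checkN_bound {D : ObjectProperty 𝒞} {U : 𝒞} (hU : S.leftPerp D U) {n : ℕ} {M : 𝒞}
    (hM : S.checkN D n M) {i : ℕ} (hi : n ≤ i) : Subsingleton (S.extSucc i U M) := by
  induction n generalizing M i with
  | zero => exact hU M hM i
  | succ n ih =>
    obtain ⟨W, K, hW, hK, hT⟩ := hM
    obtain ⟨i, rfl⟩ : ∃ j, i = j + 1 := ⟨i - 1, by omega⟩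
    exact hT.extSucc_cocone_right i (ih hK (by omega)) (hU W hW (i + 1))

/-- Each kernel of a C-cover lowers the bound by one. At bound zero 𝔼(M, K) = 0, so the cover splits
and `M` is in C. -/
lemma hat_of_bound {C : ObjectProperty 𝒞} (hC : IsSubcategory C) {n : ℕ} {M : 𝒞}
    (hM : S.leftX C M)
    (hn : ∀ i, n ≤ i → ∀ N, S.leftX C N → Subsingleton (S.extSucc i M N)) : S.hat C M := by
  induction n generalizing M with
  | zero =>
    obtain ⟨-, K, W, hW, hK, hT⟩ := leftX_cases hM
    exact ⟨0, (hT.ends_of_middle (hn 0 le_rfl K hK) hC hW).2⟩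
  | succ n ih =>
    obtain ⟨-, K, W, hW, hK, hT⟩ := leftX_cases hM
    obtain ⟨m, hm⟩ := ih hK fun i hi N hN =>
      hT.extSucc_cocone_left i (leftX_le_rightPerp _ hN W hW i) (hn (i + 1) (by omega) N hN)
    exact ⟨m + 1, K, W, hW, hm, hT⟩

lemma check_le_leftPerp {T D : ObjectProperty 𝒞} (h : T ≤ S.leftPerp D) :
    S.check T ≤ S.leftPerp D := by
  rintro A ⟨n, hA⟩
  induction n generalizing A with
  | zero => exact h _ hA
  | succ n ih =>
    obtain ⟨W, K, hW, hK, hT⟩ := hA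
    exact leftPerp_cocone hT (h _ hW) (ih _ hK)

end Bounds

/-! ### Minimal approximations and special preenvelopes. -/

section Approximation

/-- A variant of Wakamatsu's lemma: the cone of a left minimal left `D`-approximation has no
extensions by objects of the extension-closed class `D`. -/
lemma subsingleton_ext_of_minimal_approximation {D : ObjectProperty 𝒞} (hD : S.ExtClosed D)
    {A W V : 𝒞} {g : A ⟶ W} {y : W ⟶ V} {δ : S.Ext V A} (h : S.Realizes g y δ) (hW : D W)
    (happ : ∀ (W' : 𝒞) (f : A ⟶ W'), D W' → ∃ k : W ⟶ W', g ≫ k = f)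
    (hmin : ∀ ψ : W ⟶ W, g ≫ ψ = 0 → IsIso (𝟙 W - ψ)) {D' : 𝒞} (hD' : D D') :
    Subsingleton (S.Ext V D') := by
  refine subsingleton_of_forall_eq 0 fun ε => ?_
  obtain ⟨Q, p, q, hQ⟩ := S.exists_realizes (S.pull y ε)
  obtain ⟨u, hu⟩ := exists_lift_of_pull_eq_zero hQ g (by
    rw [← pull_comp, comp_eq_zero_of_realizes h, pull_zero])
  -- `Q` is an extension of `W` by D', hence in D. The endomorphism k ≫ q of `W` fixes `g`, so
  -- minimality makes it invertible and the pulled-back extension splits.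
  obtain ⟨k, hk⟩ := happ Q u (hD _ _ _ ⟨_, _, _, hQ⟩ hD' hW)
  have hiso : IsIso (k ≫ q) := by
    have := hmin (𝟙 W - k ≫ q) (by simp [reassoc_of% hk, hu])
    simpa using this
  have hy : S.pull y ε = 0 := by
    rw [← pull_id (S.pull y ε), ← IsIso.inv_hom_id (k ≫ q), pull_comp, pull_comp,
      pull_deflation hQ, map_zero, map_zero]
  obtain ⟨f, rfl⟩ := exists_push_eq_of_pull_eq_zero h ε hy
  obtain ⟨k', rfl⟩ := happ D' f hD'
  rw [push_comp, push_inflation h, map_zero]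

variable [HasFiniteBiproducts 𝒞] [S.HasEnoughProj] {X D I : ObjectProperty 𝒞}

lemma IsRelCoresolving.exists_special_preenvelope (hKS : IsKrullSchmidtCategory 𝒞) (hWIC : S.WIC)
    (hX : S.ConeClosed X) (hI : S.IsRelInjCogenerator I X) (hD : S.IsRelCoresolving D X)
    (hfin : S.IsStronglyCovariantlyFiniteIn D X) {A : 𝒞} (hA : X A) :
    ∃ W V, D W ∧ X V ∧ S.leftPerp D V ∧ S.HasTriangle A W V := by
  obtain ⟨W₀, V₀, g, y₀, hW₀, hV₀, hg, happ⟩ := hfin A hA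
  obtain ⟨n, Y, hY, ⟨e⟩⟩ := hKS W₀
  obtain ⟨W, W', e', he', hmin⟩ := exists_minimal_decomposition Y hY e g
  have hge : (g ≫ e'.hom ≫ biprod.fst) ≫ biprod.inl ≫ e'.inv = g := by
    have : g ≫ e'.hom = (g ≫ e'.hom ≫ biprod.fst) ≫ biprod.inl := by
      ext
      · simp
      · simpa using he'
    rw [← Category.assoc, ← this, Category.assoc, e'.hom_inv_id, Category.comp_id]
  -- The inflation `g` is the minimal part followed by a split inclusion, so (WIC) makes the minimal
  -- part an inflation.
  obtain ⟨V, y, δ, h⟩ := hWIC.1 (g ≫ e'.hom ≫ biprod.fst) (biprod.inl ≫ e'.inv)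
    (by rw [hge]; exact ⟨_, _, hg⟩)
  have hW : D W := hD.subcategory.summand _ _ (hD.subcategory.iso _ _ e' hW₀)
  have hV : X V := hX _ _ _ ⟨_, _, _, h⟩ hA (hD.le _ hW)
  refine ⟨W, V, hW, hV, fun D' hD' i => ?_, _, _, _, h⟩
  induction i generalizing D' with
  | zero =>
    refine subsingleton_ext_of_minimal_approximation hD.ext_closed h hW (fun W' f hW' => ?_)
      hmin hD'
    obtain ⟨k, hk⟩ := happ W' f hW'
    exact ⟨biprod.inl ≫ e'.inv ≫ k, by
      rw [← hk]; nth_rw 2 [← hge]; simp only [Category.assoc]⟩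
  | succ i ih =>
    -- Degrees above one reduce to lower ones through the cogenerator, whose objects are orthogonal
    -- to V ∈ X.
    obtain ⟨J, D'', hJ, hD'', hT⟩ := hD.exists_triangle hI hD'
    exact hT.extSucc_cocone_right i (ih D'' hD'') ((hI.le _ hJ).2 V hV (i + 1))

end Approximation

/-! ### From coresolving to tilting subcategories. -/

section Converse

lemma HasFiltration.mem_of_extClosed {P : ObjectProperty 𝒞} (hP : S.ExtClosed P)
    (h0 : ∀ Z : 𝒞, IsZero Z → P Z) {F : Set 𝒞} (hF : ∀ X ∈ F, P X) {M : 𝒞}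
    (h : S.HasFiltration F M) : P M := by
  induction h with
  | zero M h => exact h0 M h
  | step M' M X _ hX h ih => exact hP _ _ _ h ih (hF X hX)

lemma exists_checkN_of_finite {D : ObjectProperty 𝒞} (h0 : D 0) {F : Set 𝒞} (hF : F.Finite)
    (h : ∀ M ∈ F, S.check D M) : ∃ n, ∀ M ∈ F, S.checkN D n M := by
  induction F, hF using Set.Finite.induction_on with
  | empty => exact ⟨0, by simp⟩
  | @insert M s _ _ ih =>
    obtain ⟨n, hn⟩ := ih fun N hN => h N (Set.mem_insert_of_mem _ hN)
    obtain ⟨m, hm⟩ := h M (Set.mem_insert _ _)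
    refine ⟨max n m, ?_⟩
    rintro N (rfl | hN)
    · exact checkN_mono h0 (le_max_right n m) _ hm
    · exact checkN_mono h0 (le_max_left n m) _ (hn N hN)

variable [S.HasEnoughProj] [S.HasEnoughInj]

variable {C D I : ObjectProperty 𝒞} (hC : IsSubcategory C) (hself : S.IsSelfOrthogonal C)
  (hI : S.IsRelInjCogenerator I (S.leftX C)) (hD : S.IsRelCoresolving D (S.leftX C))

include hI hD in
-- In a special preenvelope A → W → V with A ∈ ^⊥D, the middle term is in ^⊥D ∩ D and `V` has a
-- shorter D-coresolution. The hypothesis on Ď makes this terminate.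
lemma IsRelCoresolving.inf_leftPerp_le_check
    (hspec : ∀ A, S.leftX C A →
      ∃ W V, D W ∧ S.leftX C V ∧ S.leftPerp D V ∧ S.HasTriangle A W V)
    (hcheck : S.check D = S.check (S.leftX C)) :
    S.leftX C ⊓ S.leftPerp D ≤ S.check (S.leftPerp D ⊓ D) := by
  rintro A ⟨hA, hA'⟩
  obtain ⟨n, hn⟩ : S.check D A := hcheck ▸ le_check _ hA
  induction n generalizing A with
  | zero => exact le_check _ ⟨hA', hn⟩
  | succ n ih =>
    obtain ⟨W, V, hW, hV, hV', hT⟩ := hspec A hA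
    exact check_cocone hT ⟨extClosed_leftPerp _ _ _ hT hA' hV', hW⟩
      (ih V hV hV' (hD.checkN_of_triangle hI hT hn hW))

include hI hD in
lemma IsRelCoresolving.exists_le_checkN (hcheck : S.check D = S.check (S.leftX C))
    (hfilt : S.IsFinitelyFiltered (S.check (S.leftX C))) :
    ∃ n, S.leftX C ≤ S.checkN D n := by
  obtain ⟨F, hF, hFX, hfilt⟩ := hfilt
  rw [← hcheck] at hFX
  obtain ⟨n, hn⟩ := exists_checkN_of_finite hD.zero_mem hF hFX
  exact ⟨n, fun M hM => (hfilt M (le_check _ hM)).mem_of_extClosed (hD.extClosed_checkN hI n)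
    (fun Z hZ => checkN_mono hD.zero_mem (Nat.zero_le n) _ (hD.subcategory.zero Z hZ)) hn⟩

include hC hself hI hD in
lemma IsRelCoresolving.isTilting
    (hspec : ∀ A, S.leftX C A →
      ∃ W V, D W ∧ S.leftX C V ∧ S.leftPerp D V ∧ S.HasTriangle A W V)
    (hcheck : S.check D = S.check (S.leftX C)) {n : ℕ} (hn : S.leftX C ≤ S.checkN D n) :
    S.IsTilting C (S.leftPerp D ⊓ D) where
  subcategory_left := hC
  subcategory_right := isSubcategory_leftPerp.inf hD.subcategory
  selfOrthogonal_left := hself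
  selfOrthogonal_right := fun A hA _ hU i => hU.1 A hA.2 i
  le_hat := fun _ hU => hat_of_bound (n := n) hC (hD.le _ hU.2) fun _ hi N hN =>
    checkN_bound hU.1 (hn N hN) hi
  le_check := fun A hA => hD.inf_leftPerp_le_check hI hspec hcheck A
    ⟨le_leftX_self hC hself A hA, fun _ hM i => leftX_le_rightPerp _ (hD.le _ hM) A hA i⟩

include hI hD in
lemma IsRelCoresolving.rightPerp_inf_eq
    (hspec : ∀ A, S.leftX C A →
      ∃ W V, D W ∧ S.leftX C V ∧ S.leftPerp D V ∧ S.HasTriangle A W V)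
    (hcheck : S.check D = S.check (S.leftX C)) :
    S.rightPerp (S.leftPerp D ⊓ D) ⊓ S.leftX C = D := by
  refine le_antisymm ?_ (le_inf (fun A hA U hU i => hU.1 A hA i) hD.le)
  rintro A ⟨hA, hA'⟩
  obtain ⟨W, V, hW, hV, hV', hT⟩ := hspec A hA'
  exact (hT.ends_of_middle (rightPerp_ext (rightPerp_le_rightPerp_check _ hA)
    (hD.inf_leftPerp_le_check hI hspec hcheck V ⟨hV, hV'⟩)) hD.subcategory hW).1

end Converse

/-! ### Finiteness of the tilting subcategory. -/

section Generator

variable [S.HasEnoughProj]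

/-- Horseshoe lemma: a triangle `A ⟶ P ⟶ Q'` lifts along a deflation `Q ⟶ A` whose kernel has
vanishing second extensions. -/
lemma exists_horseshoe {D Q A P Q' : 𝒞} (h : S.HasTriangle D Q A) (h' : S.HasTriangle A P Q')
    (hv : Subsingleton (S.extSucc 1 Q' D)) :
    ∃ R, S.HasTriangle Q R Q' ∧ S.HasTriangle D R P := by
  obtain ⟨x, y, θ, h⟩ := h
  obtain ⟨a, b, ε, h'⟩ := h'
  obtain ⟨P', hP', k, l, ζ, hZ⟩ := S.syzygy_spec Q'
  have := hP'.subsingleton_ext A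
  obtain ⟨f, rfl⟩ := exists_push_eq_of_pull_eq_zero hZ ε (Subsingleton.elim _ _)
  -- 𝔼²(Q', D) is 𝔼(ΩQ', D), the obstruction to lifting the classifying map ΩQ' → A to `Q`.
  have : Subsingleton (S.Ext (S.syzygy Q') D) := hv
  obtain ⟨g, rfl⟩ := exists_lift_of_pull_eq_zero h f (Subsingleton.elim _ _)
  obtain ⟨R, r, s, hR⟩ := S.exists_realizes (S.push g ζ)
  obtain ⟨X, d, e, i, η, -, -, h1, h2, -, -⟩ := S.et4 h hR
  replace h2 : S.Realizes d e (S.push (g ≫ y) ζ) := by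
    rw [push_comp]
    exact h2
  obtain ⟨t, -⟩ := S.realizes_unique h2 h'
  exact ⟨R, ⟨_, _, _, hR⟩, HasTriangle.iso_ends ⟨_, _, _, h1⟩ (Iso.refl _) t⟩

/-- The class of objects with a deflation from an object of `Q` with kernel in `D` is closed under
extensions if second extensions from `Q` to `D` vanish. -/
lemma extClosed_precovered {D Q : ObjectProperty 𝒞} (hD : S.ExtClosed D) (hQ : S.ExtClosed Q)
    (hv : ∀ A B, Q A → D B → Subsingleton (S.extSucc 1 A B)) :
    S.ExtClosed (fun M => ∃ K R, D K ∧ Q R ∧ S.HasTriangle K R M) := by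
  rintro A B C h ⟨K, R, hK, hR, hA⟩ ⟨K', R', hK', hR', hC⟩
  obtain ⟨P, hP, hP'⟩ := h.pullback hC
  obtain ⟨R'', h1, h2⟩ := exists_horseshoe hA hP' (hv _ _ hR' hK)
  obtain ⟨N, hN, hN'⟩ := h2.comp_deflation hP
  exact ⟨N, R'', hD _ _ _ hN hK hK', hQ _ _ _ h1 hR hR', hN'⟩

omit [S.HasEnoughProj] in
/-- If each object of `D` has a deflation from an object of `T` with kernel in `D`, then each
object of `Ď` has a deflation from an object of `Ť` with kernel in `D`. -/
lemma exists_precover_of_check {D T : ObjectProperty 𝒞} (hD : S.ExtClosed D)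
    (hT : ∀ A, D A → ∃ K W, T W ∧ D K ∧ S.HasTriangle K W A) {M : 𝒞} (hM : S.check D M) :
    ∃ K R, D K ∧ S.check T R ∧ S.HasTriangle K R M := by
  obtain ⟨n, hM⟩ := hM
  induction n generalizing M with
  | zero =>
    obtain ⟨K, W, hW, hK, h⟩ := hT M hM
    exact ⟨K, W, hK, le_check _ hW, h⟩
  | succ n ih =>
    obtain ⟨D₀, L, hD₀, hL, h⟩ := hM
    obtain ⟨K, R, hK, hR, h'⟩ := ih hL
    obtain ⟨P, hP, hP'⟩ := h.pullback h'
    -- `P` is an extension of D₀ by `K`, so it is in D and has a T-cover; composing with P → R makes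
    -- the new cover of `M` the cocone of W → R.
    obtain ⟨K', W, hW, hK', h''⟩ := hT P (hD _ _ _ hP hK hD₀)
    obtain ⟨N, hN, hN'⟩ := h''.comp_deflation hP'
    exact ⟨K', N, hK', check_cocone hN' hW hR, hN⟩

variable [HasFiniteBiproducts 𝒞]

omit [S.HasEnoughProj] in
lemma exists_check_addClosure {T : ObjectProperty 𝒞} (hT : IsSubcategory T) {A : 𝒞}
    (hA : S.check T A) : ∃ T₀, T T₀ ∧ S.check (addClosure T₀) A := by
  obtain ⟨n, hA⟩ := hA
  induction n generalizing A with
  | zero => exact ⟨A, hA, le_check _ (mem_addClosure_self A)⟩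
  | succ n ih =>
    obtain ⟨W, K, hW, hK, h⟩ := hA
    obtain ⟨T₀, hT₀, hK'⟩ := ih hK
    exact ⟨T₀ ⊞ W, hT.biprod _ _ hT₀ hW, check_cocone h
      (addClosure_le_addClosure_biprod_right _ _ _ (mem_addClosure_self W))
      (check_monotone (addClosure_le_addClosure_biprod_left _ _) _ hK')⟩

omit [S.HasEnoughProj] in
lemma exists_precover_addClosure_of_finite {D T : ObjectProperty 𝒞} (hT : IsSubcategory T)
    {F : Set 𝒞} (hF : F.Finite)
    (h : ∀ M ∈ F, ∃ K R, D K ∧ S.check T R ∧ S.HasTriangle K R M) :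
    ∃ T₀, T T₀ ∧ ∀ M ∈ F, ∃ K R, D K ∧ S.check (addClosure T₀) R ∧ S.HasTriangle K R M := by
  induction F, hF using Set.Finite.induction_on with
  | empty => exact ⟨0, hT.zero _ (isZero_zero 𝒞), by simp⟩
  | @insert M s _ _ ih =>
    obtain ⟨T₀, hT₀, hs⟩ := ih fun N hN => h N (Set.mem_insert_of_mem _ hN)
    obtain ⟨K, R, hK, hR, hM⟩ := h M (Set.mem_insert _ _)
    obtain ⟨T₁, hT₁, hR⟩ := exists_check_addClosure hT hR
    refine ⟨T₀ ⊞ T₁, hT.biprod _ _ hT₀ hT₁, ?_⟩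
    rintro N (rfl | hN)
    · exact ⟨K, R, hK,
        check_monotone (addClosure_le_addClosure_biprod_right _ _) _ hR, hM⟩
    · obtain ⟨K, R, hK, hR, hN⟩ := hs N hN
      exact ⟨K, R, hK, check_monotone (addClosure_le_addClosure_biprod_left _ _) _ hR, hN⟩

variable [S.HasEnoughInj] {C D : ObjectProperty 𝒞}
  (hD : S.IsRelCoresolving D (S.leftX C))

include hD in
lemma IsRelCoresolving.isFiniteSubcategory (hcheck : S.check D = S.check (S.leftX C))
    (hfilt : S.IsFinitelyFiltered (S.check (S.leftX C)))
    (hDT : S.leftX (S.leftPerp D ⊓ D) = D) : IsFiniteSubcategory (S.leftPerp D ⊓ D) := by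
  have hTsub : IsSubcategory (S.leftPerp D ⊓ D) := isSubcategory_leftPerp.inf hD.subcategory
  obtain ⟨F, hF, hFX, hfilt⟩ := hfilt
  rw [← hcheck] at hFX
  have hpre : ∀ M, S.check D M →
      ∃ K R, D K ∧ S.check (S.leftPerp D ⊓ D) R ∧ S.HasTriangle K R M := fun M hM =>
    exists_precover_of_check hD.ext_closed (fun A hA => by
      obtain ⟨-, K, W, hW, hK, hT⟩ := leftX_cases (hDT.ge _ hA)
      exact ⟨K, W, hW, hDT.le _ hK, hT⟩) hM
  obtain ⟨T₀, hT₀, hFT⟩ := exists_precover_addClosure_of_finite hTsub hF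
    fun M hM => hpre M (hFX M hM)
  have hle : addClosure T₀ ≤ S.leftPerp D ⊓ D := addClosure_le hTsub hT₀
  have hadd := isSubcategory_addClosure T₀
  have h0 : addClosure T₀ 0 := hadd.zero _ (isZero_zero 𝒞)
  have hcheckext : S.ExtClosed (S.check (addClosure T₀)) :=
    extClosed_check_of_selfOrthogonal h0 hadd.biprod hadd.iso
      fun A hA U hU i => (hle _ hU).1 A (hle _ hA).2 i
  have hcl : S.check (addClosure T₀) ≤ S.leftPerp D := check_le_leftPerp (hle.trans inf_le_left)
  refine ⟨T₀, le_antisymm (fun U hU => ?_) hle⟩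
  have hUf : S.HasFiltration F U := hfilt U (hcheck ▸ le_check _ hU.2)
  obtain ⟨K, R, hK, hR, h⟩ := hUf.mem_of_extClosed
    (extClosed_precovered hD.ext_closed hcheckext fun A B hA hB => hcl _ hA B hB 1)
    (fun Z hZ => ⟨0, Z, hD.zero_mem, le_check _ (hadd.zero Z hZ), S.hasTriangle_zero_self Z⟩) hFT
  have hUK := leftPerp_ext hU.1 hK
  have hK' := (h.ends_of_middle hUK isSubcategory_leftPerp (hcl _ hR)).1
  obtain ⟨W, L, hW, hL, hT⟩ := check_cases h0 hR
  -- As a summand of `R`, `U` embeds into `W`, with cone an extension of `L` by `K`. This cone is in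
  -- ^⊥D and U ∈ D, so `U` is a summand of `W`.
  obtain ⟨N, hN, hN'⟩ := (h.flip hUK).comp_inflation hT
  have hN'' := extClosed_leftPerp _ _ _ hN hK' (hcl _ hL)
  exact (hN'.ends_of_middle (leftPerp_ext hN'' hU.2) hadd hW).1

end Generator
end Extriangulated

/-! ### The correspondence. -/

theorem mainTheorem2 {𝒞 : Type u} [Category.{v} 𝒞] [Preadditive 𝒞] [HasZeroObject 𝒞]
    [HasBinaryBiproducts 𝒞] [HasFiniteBiproducts 𝒞]
    (S : Extriangulated.{w} 𝒞) [S.HasEnoughProj] [S.HasEnoughInj]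
    (hKS : IsKrullSchmidtCategory 𝒞) (hWIC : S.WIC)
    (C : ObjectProperty 𝒞) (hC : IsSubcategory C) (hself : S.IsSelfOrthogonal C)
    (hinj : ∃ I : ObjectProperty 𝒞, S.IsRelInjCogenerator I (S.leftX C))
    (hfilt : S.IsFinitelyFiltered (S.check (S.leftX C))) :
    (∀ T : ObjectProperty 𝒞, IsFiniteSubcategory T → S.IsTilting C T →
      S.leftX T = S.rightPerp T ⊓ S.leftX C) ∧
    Set.BijOn (fun T : ObjectProperty 𝒞 => S.rightPerp T ⊓ S.leftX C)
      {T | IsFiniteSubcategory T ∧ S.IsTilting C T}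
      {D | S.IsRelCoresolving D (S.leftX C) ∧ S.IsStronglyCovariantlyFiniteIn D (S.leftX C) ∧
        S.check D = S.check (S.leftX C)} ∧
    Set.InvOn (fun D : ObjectProperty 𝒞 => S.leftPerp D ⊓ D)
      (fun T : ObjectProperty 𝒞 => S.rightPerp T ⊓ S.leftX C)
      {T | IsFiniteSubcategory T ∧ S.IsTilting C T}
      {D | S.IsRelCoresolving D (S.leftX C) ∧ S.IsStronglyCovariantlyFiniteIn D (S.leftX C) ∧
        S.check D = S.check (S.leftX C)} := by
  obtain ⟨I, hI⟩ := hinj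
  have hmaps : Set.MapsTo (fun T : ObjectProperty 𝒞 => S.rightPerp T ⊓ S.leftX C)
      {T | IsFiniteSubcategory T ∧ S.IsTilting C T}
      {D | S.IsRelCoresolving D (S.leftX C) ∧ S.IsStronglyCovariantlyFiniteIn D (S.leftX C) ∧
        S.check D = S.check (S.leftX C)} := by
    rintro T ⟨hfin, hT⟩
    obtain ⟨n, hn⟩ := hT.exists_bound hfin
    exact ⟨hT.isRelCoresolving hI, hT.isStronglyCovariantlyFiniteIn hn, hT.check_eq hI hn⟩
  have hinv : Set.LeftInvOn (fun D : ObjectProperty 𝒞 => S.leftPerp D ⊓ D)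
      (fun T : ObjectProperty 𝒞 => S.rightPerp T ⊓ S.leftX C)
      {T | IsFiniteSubcategory T ∧ S.IsTilting C T} := by
    rintro T ⟨hfin, hT⟩
    obtain ⟨n, hn⟩ := hT.exists_bound hfin
    exact hT.leftPerp_inf_eq hn
  have hconv : ∀ D, S.IsRelCoresolving D (S.leftX C) →
      S.IsStronglyCovariantlyFiniteIn D (S.leftX C) → S.check D = S.check (S.leftX C) →
      (IsFiniteSubcategory (S.leftPerp D ⊓ D) ∧ S.IsTilting C (S.leftPerp D ⊓ D)) ∧
        S.rightPerp (S.leftPerp D ⊓ D) ⊓ S.leftX C = D := by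
    intro D hD hfin hcheck
    have hspec := fun A hA => hD.exists_special_preenvelope hKS hWIC
      (Extriangulated.coneClosed_leftX hC hself) hI hfin (A := A) hA
    obtain ⟨n, hn⟩ := hD.exists_le_checkN hI hcheck hfilt
    have hT := hD.isTilting hC hself hI hspec hcheck hn
    have heq := hD.rightPerp_inf_eq hI hspec hcheck
    -- The bound comes from the filtration here, since finiteness of ^⊥D ∩ D is not yet known and
    -- its proof uses this equality.
    have hDT := hT.leftX_eq (n := n) fun i hi M hM U hU =>
      Extriangulated.checkN_bound hU.1 (hn M hM) hi
    exact ⟨⟨hD.isFiniteSubcategory hcheck hfilt (hDT.trans heq), hT⟩, heq⟩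
  refine ⟨fun T hfin hT => ?_, ⟨hmaps, hinv.injOn, ?_⟩, hinv, ?_⟩
  · obtain ⟨n, hn⟩ := hT.exists_bound hfin
    exact hT.leftX_eq hn
  · rintro D ⟨hD, hfin, hcheck⟩
    obtain ⟨hT, heq⟩ := hconv D hD hfin hcheck
    exact ⟨_, hT, heq⟩
  · rintro D ⟨hD, hfin, hcheck⟩
    exact (hconv D hD hfin hcheck).2
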